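/- For integers $k \ge 1$ and $n \ge 2k+1$, let $G_{n,k}$ be the $k$-nearest-neighbor circulant graph on $n$ nodes $0,\dots,n-1$, in which node $i$ is adjacent to $i\pm1,\dots,i\pm k$ modulo $n$. Let $A$ be its adjacency matrix, $L$ its graph Laplacian, and $\lambda_1(L)\le\cdots\le\lambda_n(L)$ the eigenvalues of $L$. For a coupling constant $K>0$ consider the Kuramoto system $$\frac{d\theta_i}{dt} = K\sum_{j} A_{ij}\sin(\theta_j-\theta_i).$$ A zero $\theta$ of the right-hand side is an equilibrium; it is *stable* if it is Lyapunov stable and every trajectory starting close enough to it converges to $\theta + c\mathbf 1$ for some $c\in\mathbf R$ (the system is invariant under common phase shifts); it is *unsynchronized* if the $\theta_i$ are not all equal modulo $2\pi$. The *twisted state* is $\theta_i = 2\pi i/n$. 1. There is $N$ such that for all $n\ge N$ and all $k \ge 1$ with $n \ge 2k+1$: if $\lambda_n(L)/\lambda_2(L) > 2$, then, for every $K>0$, the twisted state is an unsynchronized stable equilibrium of the Kuramoto system on $G_{n,k}$. 2. Let $$\kappa(\mu) = \frac{\mu - \frac{\sin(2\pi\mu)}{2\pi}}{\mu-\frac{\sin(\pi\mu)}{\pi}}.$$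 If $n,k\to\infty$ with $2k/n\to\mu\ge 0.6$, then $\lambda_n(L)/\lambda_2(L)\to\kappa(\mu)$. The function $\kappa$ is analytic and strictly decreasing on $[0.6,1]$, and $\kappa(\mu_c)=2$, where $\mu_c\approx 0.68$ (precisely, $|\mu_c-0.68|<0.005$) is the critical density: for every $K>0$, whenever $n,k\to\infty$ with $2k/n\to\mu$, the twisted state is eventually a stable equilibrium if $\mu<\mu_c$, and eventually not a stable equilibrium if $\mu>\mu_c$. 3. Consequently, for every $\epsilon>0$ there are $k\ge1$ and $n\ge 2k+1$ such that $\lambda_n(L)/\lambda_2(L)\le 2+\epsilon$ for $G_{n,k}$ and, for every $K>0$, the twisted state is an unsynchronized stable equilibrium of the Kuramoto system on $G_{n,k}$. -/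

import Mathlib

open Filter Topology

noncomputable section

namespace Kuramoto

/-- The `k`-nearest-neighbor circulant graph on the `n` nodes `0, …, n - 1`: node `i` is joined to
`i ± 1, …, i ± k` modulo `n`. -/
def circulant (n k : ℕ) : SimpleGraph (Fin n) where
  Adj i j := i ≠ j ∧ ∃ d : ℕ, 1 ≤ d ∧ d ≤ k ∧
    ((i : ℕ) + d ≡ (j : ℕ) [MOD n] ∨ (j : ℕ) + d ≡ (i : ℕ) [MOD n])
  symm := ⟨fun _ _ h => ⟨h.1.symm, h.2.imp fun _ hd => ⟨hd.1, hd.2.1, hd.2.2.symm⟩⟩⟩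
  loopless := ⟨fun _ h => h.1 rfl⟩

/-- The admissible sizes: `k ≥ 1` and `n ≥ 2k + 1`. -/
def Admissible (n k : ℕ) : Prop := 1 ≤ k ∧ 2 * k + 1 ≤ n

open Classical in
/-- The adjacency matrix of the circulant graph. -/
def adj (n k : ℕ) : Matrix (Fin n) (Fin n) ℝ := (circulant n k).adjMatrix ℝ

open Classical in
/-- The graph Laplacian of the circulant graph. -/
def lap (n k : ℕ) : Matrix (Fin n) (Fin n) ℝ := (circulant n k).lapMatrix ℝ

theorem lap_isHermitian (n k : ℕ) : (lap n k).IsHermitian := by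
  classical
  exact SimpleGraph.isHermitian_lapMatrix ..

/-- The `m`-th eigenvalue `λ_m` of a real symmetric `n × n` matrix in increasing order,
`λ_1 ≤ ⋯ ≤ λ_n`, counted with multiplicity (`eigenvalues₀` lists them in decreasing order,
starting from the index `0`). Only used for `1 ≤ m ≤ n`. -/
def eig {n : ℕ} {M : Matrix (Fin n) (Fin n) ℝ} (hM : M.IsHermitian) (m : ℕ) : ℝ :=
  if h : 1 ≤ m ∧ m ≤ n then
    hM.eigenvalues₀ ⟨n - m, by rw [Fintype.card_fin]; omega⟩
  else 0

/-- The condition number `λ_n(L) / λ_2(L)` of the graph Laplacian. For admissible `n, k` the graph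
is connected, so that the denominator is positive. -/
def condNumber (n k : ℕ) : ℝ := eig (lap_isHermitian n k) n / eig (lap_isHermitian n k) 2

/-- The right-hand side of the Kuramoto system `θ_i' = K ∑_j A_ij sin (θ_j - θ_i)`. -/
def field {n : ℕ} (K : ℝ) (A : Matrix (Fin n) (Fin n) ℝ) (θ : Fin n → ℝ) : Fin n → ℝ :=
  fun i => K * ∑ j, A i j * Real.sin (θ j - θ i)

/-- `φ` solves the Kuramoto system for all times `t ≥ 0`. -/
def IsTrajectory {n : ℕ} (K : ℝ) (A : Matrix (Fin n) (Fin n) ℝ) (φ : ℝ → Fin n → ℝ) : Prop :=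
  ∀ t : ℝ, 0 ≤ t → HasDerivWithinAt φ (field K A (φ t)) (Set.Ici 0) t

/-- `θ` is an equilibrium of the Kuramoto system. -/
def IsEquilibrium {n : ℕ} (K : ℝ) (A : Matrix (Fin n) (Fin n) ℝ) (θ : Fin n → ℝ) : Prop :=
  field K A θ = 0

/-- `θ` is a stable equilibrium of the Kuramoto system: it is an equilibrium, it is stable in the
sense of Lyapunov, and every trajectory that starts close enough to it converges to it up to a
common shift of all phases (the system is invariant under such shifts). -/
def IsStableEquilibrium {n : ℕ} (K : ℝ) (A : Matrix (Fin n) (Fin n) ℝ) (θ : Fin n → ℝ) : Prop :=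
  IsEquilibrium K A θ ∧
  (∀ ε : ℝ, 0 < ε → ∃ δ : ℝ, 0 < δ ∧ ∀ φ : ℝ → Fin n → ℝ, IsTrajectory K A φ →
    ‖φ 0 - θ‖ < δ → ∀ t : ℝ, 0 ≤ t → ‖φ t - θ‖ < ε) ∧
  (∃ δ : ℝ, 0 < δ ∧ ∀ φ : ℝ → Fin n → ℝ, IsTrajectory K A φ →
    ‖φ 0 - θ‖ < δ → ∃ c : ℝ, Tendsto φ atTop (𝓝 fun i => θ i + c))

/-- All phases agree modulo `2π`. -/
def IsSynchronized {n : ℕ} (θ : Fin n → ℝ) : Prop :=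
  ∀ i j, (θ i : Real.Angle) = (θ j : Real.Angle)

/-- The (first) twisted state `θ_i = 2π i / n`. -/
def twisted (n : ℕ) : Fin n → ℝ := fun i => 2 * Real.pi * (i : ℕ) / n

/-- The sequence of circulant graphs with parameters `(n j, k j)` has limiting density `μ`:
`n, k → ∞` and `2k / n → μ`. -/
def HasDensity (n k : ℕ → ℕ) (μ : ℝ) : Prop :=
  (∀ j, Admissible (n j) (k j)) ∧ Tendsto n atTop atTop ∧ Tendsto k atTop atTop ∧
    Tendsto (fun j => 2 * (k j : ℝ) / (n j : ℝ)) atTop (𝓝 μ)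

/-- `μc` is the critical density: in the limit `n, k → ∞` with `2k / n → μ`, the twisted state is
eventually a stable equilibrium if `μ < μc`, and eventually not a stable one if `μ > μc`. -/
def IsCriticalDensity (K μc : ℝ) : Prop :=
  ∀ (n k : ℕ → ℕ) (μ : ℝ), HasDensity n k μ →
    (μ < μc → ∀ᶠ j in atTop, IsStableEquilibrium K (adj (n j) (k j)) (twisted (n j))) ∧
    (μc < μ → ∀ᶠ j in atTop, ¬ IsStableEquilibrium K (adj (n j) (k j)) (twisted (n j)))

/-- The limiting condition number. -/
def kappa (μ : ℝ) : ℝ :=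
  (μ - Real.sin (2 * Real.pi * μ) / (2 * Real.pi)) / (μ - Real.sin (Real.pi * μ) / Real.pi)

end Kuramoto

end

namespace Kuramoto

open Real Finset

/-! ### Sums over the neighbours of a node -/

/-! Everything commutes with rotations of the ring, so the Fourier modes diagonalize it. With q =
2k+1 and x = π/n the Dirichlet kernel gives the Laplacian eigenvalues λ(m) = q - sin(q m x)/sin(m x)
for 0 < m < n (`lam_eq`). The linearization at the twisted state is -K times a Laplacian with
weights cos(2π(j-i)/n), whose eigenvalues are w(m) = (λ(m+1) + λ(m-1))/2 - λ(1) (`weig_one`).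

Since λ(1) is the least nonzero eigenvalue (`lam_one_le`), it is λ_2(L), and only m = 1 and its
mirror image n-1 can destabilize when n ≥ 2k+3: there w = λ(2)/2 - λ(1), and stability is decided by
whether λ(2)/λ(1) exceeds 2. The condition number is max λ(m)/λ(1). For q/n ≤ 0.6 one has λ(2) >
2λ(1) outright; for 0.6 ≤ q/n ≤ 0.7 the maximum is λ(2), so the two ratios coincide; for q/n ≥ 0.7
no λ(m) exceeds 2λ(1), so a condition number above 2 cannot occur. The numerical estimates are valid
once n ≥ 40.

Linear stability becomes nonlinear stability through exponential decay of the squared distance,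
using conservation of the mean phase (`exists_decay`). Instability holds because the flow decreases
an energy of which the twisted state is not a local minimum (`exists_energy_lt`).

In the limit λ(m)/q tends to 1 - sin(mπμ)/(mπμ), which for μ ≥ 0.6 is largest at m = 2
(`sin_two_mul_div_le`); a tail bound uniform in m makes κ(μ) the limiting condition number. A
trigonometric inequality makes κ decrease, numerical bounds place its crossing of 2 between 0.675
and 0.685, and densities just below the crossing give the last claim. -/

theorem sum_adj_mul {n k : ℕ} (h : Admissible n k) (i : Fin n) (g : ℤ → ℝ)
    (hg : ∀ t, g (t + n) = g t) :
    ∑ j : Fin n, adj n k i j * g (j : ℕ) =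
      ∑ d ∈ Finset.Icc 1 k, (g ((i : ℕ) + d) + g ((i : ℕ) - d)) := by
  classical
  obtain ⟨hk, hn⟩ := h
  have hn0 : (0 : ℤ) < n := by omega
  have hper : Function.Periodic g (n : ℤ) := hg
  have hmod : ∀ t : ℤ, g (t % n) = g t := by
    intro t
    have h1 : t % n = t - (t / n) * n := by
      have := Int.emod_add_mul_ediv t n
      linarith [mul_comm (t / (n : ℤ)) n]
    rw [h1]
    simpa using hper.sub_int_mul_eq (t / n) (x := t)
  let τ : ℤ → Fin n := fun t => ⟨(t % n).toNat, by
    have := Int.emod_lt_of_pos t hn0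
    have := Int.emod_nonneg t hn0.ne'
    omega⟩
  have hτ : ∀ t, (((τ t : Fin n) : ℕ) : ℤ) = t % n := fun t =>
    Int.toNat_of_nonneg (Int.emod_nonneg t hn0.ne')
  have hτg : ∀ t, g ((τ t : Fin n) : ℕ) = g t := fun t => by rw [hτ, hmod]
  have hτeq : ∀ s t, τ s = τ t → (n : ℤ) ∣ s - t := by
    intro s t hst
    have : s % n = t % n := by rw [← hτ, ← hτ, hst]
    exact Int.ModEq.dvd (Int.ModEq.symm this)
  have hsmall : ∀ s t, τ s = τ t → |s - t| < n → s = t := by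
    intro s t hst hlt
    have := Int.eq_zero_of_abs_lt_dvd (hτeq s t hst) hlt
    omega
  have hnat : ∀ a b : ℕ, a ≡ b [MOD n] ↔ (n : ℤ) ∣ (b : ℤ) - a := fun a b => Nat.modEq_iff_dvd
  have hτi : ∀ (t : ℤ) (j : Fin n), (n : ℤ) ∣ (j : ℕ) - t → τ t = j := by
    intro t j hd
    apply Fin.ext
    have h1 : ((j : ℕ) : ℤ) % n = t % n := 
      Int.ModEq.symm ((Int.modEq_iff_dvd).2 hd)
    have h2 : ((j : ℕ) : ℤ) % n = (j : ℕ) :=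
      Int.emod_eq_of_lt (by omega) (by exact_mod_cast j.2)
    have := hτ t
    omega
  have hτd : ∀ t : ℤ, (n : ℤ) ∣ (((τ t : Fin n) : ℕ) : ℤ) - t := by
    intro t
    rw [hτ]
    exact (Int.mod_modEq t n).symm.dvd
  have hL : ∑ j : Fin n, adj n k i j * g (j : ℕ) =
      ∑ j ∈ univ.filter (fun j => (circulant n k).Adj i j), g (j : ℕ) := by
    rw [Finset.sum_filter]
    refine Finset.sum_congr rfl fun j _ => ?_
    simp [adj, SimpleGraph.adjMatrix_apply]
  -- The disjoint sum of two copies of `Icc 1 k` encodes the signed offsets ±d. As 2k < n, these are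
  -- nonzero and pairwise incongruent modulo n, so reduction `τ` maps them bijectively onto the
  -- neighbours.
  have hR : ∑ d ∈ Finset.Icc 1 k, (g ((i : ℕ) + d) + g ((i : ℕ) - d)) =
      ∑ x ∈ (Finset.Icc 1 k).disjSum (Finset.Icc 1 k),
        Sum.elim (fun d : ℕ => g ((i : ℕ) + d)) (fun d : ℕ => g ((i : ℕ) - d)) x := by
    rw [Finset.sum_disjSum, Finset.sum_add_distrib]; rfl
  rw [hL, hR]
  symm
  refine Finset.sum_bij
    (fun x _ => Sum.elim (fun d : ℕ => τ ((i : ℕ) + d)) (fun d : ℕ => τ ((i : ℕ) - d)) x)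
    ?_ ?_ ?_ ?_
  · rintro (d | d) hx <;> simp only [Finset.inl_mem_disjSum, Finset.inr_mem_disjSum,
      Finset.mem_Icc] at hx
    · simp only [Sum.elim_inl, Finset.mem_filter, Finset.mem_univ, true_and]
      refine ⟨fun he => ?_, d, hx.1, hx.2, Or.inl ?_⟩
      · have := hτd ((i : ℕ) + d)
        rw [← he] at this
        have h0 := Int.eq_zero_of_abs_lt_dvd this (by rw [abs_lt]; constructor <;> omega)
        omega
      · rw [hnat]; push_cast; exact hτd _
    · simp only [Sum.elim_inr, Finset.mem_filter, Finset.mem_univ, true_and]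
      refine ⟨fun he => ?_, d, hx.1, hx.2, Or.inr ?_⟩
      · have := hτd ((i : ℕ) - d)
        rw [← he] at this
        have h0 := Int.eq_zero_of_abs_lt_dvd this (by rw [abs_lt]; constructor <;> omega)
        omega
      · rw [hnat]; push_cast
        have := dvd_neg.2 (hτd ((i : ℕ) - d))
        rwa [neg_sub, sub_sub, add_comm] at this
  · rintro (d | d) hx (e | e) hy hxy <;>
      simp only [Finset.inl_mem_disjSum, Finset.inr_mem_disjSum, Finset.mem_Icc] at hx hy <;>
      simp only [Sum.elim_inl, Sum.elim_inr] at hxy <;>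
      have h0 := hsmall _ _ hxy (by rw [abs_lt]; constructor <;> omega) <;>
      (congr 1; omega)
  · intro j hj
    simp only [Finset.mem_filter, Finset.mem_univ, true_and] at hj
    obtain ⟨-, d, h1, h2, h3 | h3⟩ := hj
    · refine ⟨Sum.inl d, by simp [h1, h2], hτi _ _ ?_⟩
      rw [hnat] at h3; push_cast at h3; exact h3
    · refine ⟨Sum.inr d, by simp [h1, h2], hτi _ _ ?_⟩
      rw [hnat] at h3; push_cast at h3
      have := dvd_neg.2 h3
      rwa [neg_sub, ← sub_sub_eq_add_sub] at this
  · rintro (d | d) _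
    · exact (hτg _).symm
    · exact (hτg _).symm

theorem adj_symm (n k : ℕ) (i j : Fin n) : adj n k i j = adj n k j i := by
  classical
  simp [adj, SimpleGraph.adjMatrix_apply, SimpleGraph.adj_comm]

theorem adj_nonneg (n k : ℕ) (i j : Fin n) : 0 ≤ adj n k i j := by
  classical
  simp only [adj, SimpleGraph.adjMatrix_apply]
  split_ifs <;> norm_num

theorem adj_le_one (n k : ℕ) (i j : Fin n) : adj n k i j ≤ 1 := by
  classical
  simp only [adj, SimpleGraph.adjMatrix_apply]
  split_ifs <;> norm_num

/-! ### Trigonometric sums -/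

/-- The Dirichlet kernel, kept free of division so that zeros of sin x need no separate treatment.
-/
theorem sin_mul_sum_cos (x : ℝ) (k : ℕ) :
    sin x * (1 + 2 * ∑ d ∈ Finset.Icc 1 k, cos (2 * d * x)) = sin ((2 * k + 1) * x) := by
  induction k with
  | zero => simp
  | succ k ih =>
    rw [Finset.sum_Icc_succ_top (by omega), mul_add 2, ← add_assoc, mul_add (sin x), ih]
    have h1 : (2 * (k : ℝ) + 1) * x = 2 * (k + 1) * x - x := by ring
    have h2 : (2 * ((k + 1 : ℕ) : ℝ) + 1) * x = 2 * (k + 1) * x + x := by push_cast; ring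
    rw [h1, h2, sin_sub, sin_add]
    push_cast
    ring

theorem two_sin_mul_sum_range_cos (b : ℝ) (N : ℕ) :
    2 * sin (b / 2) * ∑ m ∈ Finset.range N, cos (m * b) = sin (N * b - b / 2) + sin (b / 2) := by
  induction N with
  | zero => simp
  | succ N ih =>
    rw [Finset.sum_range_succ, mul_add, ih]
    have h2 : ((N + 1 : ℕ) : ℝ) * b - b / 2 = N * b + b / 2 := by push_cast; ring
    rw [h2, sin_sub, sin_add]
    ring

theorem sin_pi_mul_div_ne_zero {n : ℕ} (t : ℤ) (h0 : t ≠ 0) (ht : |t| < n) :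
    sin (π * t / n) ≠ 0 := by
  have hn : (n : ℝ) ≠ 0 := by
    have : 0 < n := by have := abs_nonneg t; omega
    positivity
  intro h
  obtain ⟨a, ha⟩ := Real.sin_eq_zero_iff.1 h
  have h1 : ((a * n : ℤ) : ℝ) = (t : ℤ) := by
    have hpi := Real.pi_ne_zero
    field_simp at ha
    push_cast; linarith
  have h2 : a * n = t := by exact_mod_cast h1
  exact h0 (Int.eq_zero_of_abs_lt_dvd ⟨a, by rw [← h2]; ring⟩ ht)

theorem sum_cos_orthogonal {n : ℕ} (i j : Fin n) :
    ∑ m ∈ Finset.range n, cos (m * (2 * π * (i : ℕ) / n - 2 * π * (j : ℕ) / n)) =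
      if i = j then (n : ℝ) else 0 := by
  have hn : (n : ℝ) ≠ 0 := by
    have := i.2
    have : 0 < n := by omega
    positivity
  split_ifs with h
  · subst h; simp
  · set b := 2 * π * (i : ℕ) / n - 2 * π * (j : ℕ) / n with hb
    have hne : ((i : ℕ) : ℤ) - (j : ℕ) ≠ 0 := by
      intro h0; exact h (Fin.ext (by omega))
    have h1 := two_sin_mul_sum_range_cos b n
    -- n b is a multiple of 2π, so the two sines on the right of the telescoped sum cancel.
    have h2 : (n : ℝ) * b - b / 2 = ((((i : ℕ) : ℤ) - (j : ℕ) : ℤ) : ℝ) * (2 * π) - b / 2 := by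
      rw [hb]; push_cast; field_simp
    rw [h2, sub_eq_neg_add, Real.sin_add_int_mul_two_pi, Real.sin_neg, neg_add_cancel] at h1
    have h3 : b / 2 = π * ((((i : ℕ) : ℤ) - (j : ℕ) : ℤ) : ℝ) / n := by
      rw [hb]; push_cast; field_simp
    have h4 : sin (b / 2) ≠ 0 := by
      rw [h3]
      apply sin_pi_mul_div_ne_zero _ hne
      rw [abs_lt]; constructor <;> omega
    simpa [h4] using h1

/-! ### The discrete Fourier basis -/

/-- The real Fourier mode `cos (2π m i / n)`. -/
noncomputable def cosMode (n m : ℕ) : Fin n → ℝ := fun i => cos (m * (2 * π * (i : ℕ) / n))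

/-- The real Fourier mode `sin (2π m i / n)`. -/
noncomputable def sinMode (n m : ℕ) : Fin n → ℝ := fun i => sin (m * (2 * π * (i : ℕ) / n))

/-- Parseval for the redundant family of all 2n real modes. Using every m < n with both cosine and
sine gives the single constant n and spares a choice of basis depending on the parity of n. -/
theorem sum_modes_mul {n : ℕ} (u v : Fin n → ℝ) :
    ∑ m ∈ Finset.range n, ((cosMode n m ⬝ᵥ u) * (cosMode n m ⬝ᵥ v) +
      (sinMode n m ⬝ᵥ u) * (sinMode n m ⬝ᵥ v)) = n * (u ⬝ᵥ v) := by
  have h1 : ∀ m, (cosMode n m ⬝ᵥ u) * (cosMode n m ⬝ᵥ v) +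
      (sinMode n m ⬝ᵥ u) * (sinMode n m ⬝ᵥ v) =
      ∑ i : Fin n, ∑ j : Fin n, cos (m * (2 * π * (i : ℕ) / n - 2 * π * (j : ℕ) / n)) * (u i * v j) := by
    intro m
    simp only [dotProduct, Finset.sum_mul_sum, cosMode, sinMode]
    rw [← Finset.sum_add_distrib]
    refine Finset.sum_congr rfl fun i _ => ?_
    rw [← Finset.sum_add_distrib]
    refine Finset.sum_congr rfl fun j _ => ?_
    rw [mul_sub, Real.cos_sub]
    ring
  simp_rw [h1]
  rw [Finset.sum_comm]
  simp only [dotProduct, Finset.mul_sum]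
  refine Finset.sum_congr rfl fun i _ => ?_
  rw [Finset.sum_comm]
  simp_rw [← Finset.sum_mul, sum_cos_orthogonal, ite_mul, zero_mul]
  simp

/-- The operator `u ↦ ∑ j, A i j cos (2π p (j - i) / n) (u i - u j)`, a Laplacian with weights. -/
noncomputable def wlap (n k p : ℕ) (u : Fin n → ℝ) : Fin n → ℝ := fun i =>
  ∑ j, adj n k i j * cos (p * (2 * π * (j : ℕ) / n - 2 * π * (i : ℕ) / n)) * (u i - u j)

/-- The eigenvalue of the weighted Laplacian at the Fourier mode `m`. -/
noncomputable def weig (n k : ℕ) (p m : ℝ) : ℝ :=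
  2 * ∑ d ∈ Finset.Icc 1 k, cos (p * (2 * π * d / n)) * (1 - cos (m * (2 * π * d / n)))

theorem periodic_mode {n : ℕ} (hn : n ≠ 0) (f : ℝ → ℝ) (hf : Function.Periodic f (2 * π)) (m : ℕ)
    (t : ℤ) : f (m * (2 * π * ((t + n : ℤ) : ℝ) / n)) = f (m * (2 * π * (t : ℝ) / n)) := by
  have hn' : (n : ℝ) ≠ 0 := by exact_mod_cast hn
  have : (m : ℝ) * (2 * π * ((t + n : ℤ) : ℝ) / n) = m * (2 * π * (t : ℝ) / n) + m * (2 * π) := by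
    push_cast; field_simp
  rw [this]
  exact hf.nat_mul m _

/-- The weights at the offsets d and -d agree, so only f(x+y) + f(x-y) enters; this one identity
covers cosine and sine together. -/
theorem wlap_mode {n k : ℕ} (h : Admissible n k) (p m : ℕ) (f : ℝ → ℝ)
    (hf : Function.Periodic f (2 * π)) (hadd : ∀ x y, f (x + y) + f (x - y) = 2 * f x * cos y) :
    wlap n k p (fun i => f (m * (2 * π * (i : ℕ) / n))) =
      fun i : Fin n => weig n k p m * f (m * (2 * π * (i : ℕ) / n)) := by
  have hn0 : n ≠ 0 := by have := h.2; omega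
  have hn' : (n : ℝ) ≠ 0 := by exact_mod_cast hn0
  funext i
  have h1 := sum_adj_mul h i (fun t : ℤ => cos (p * (2 * π * ((t - (i : ℕ) : ℤ) : ℝ) / n)) *
    (f (m * (2 * π * (i : ℕ) / n)) - f (m * (2 * π * (t : ℝ) / n)))) (by
      intro t
      have e1 := periodic_mode hn0 cos Real.cos_periodic p (t - (i : ℕ))
      have e2 := periodic_mode hn0 f hf m t
      rw [show t + (n : ℤ) - ((i : ℕ) : ℤ) = t - (i : ℕ) + n by ring, e1, e2])
  simp only [wlap]
  have h2 : ∀ j : Fin n, adj n k i j * cos (p * (2 * π * (j : ℕ) / n - 2 * π * (i : ℕ) / n)) *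
      (f (m * (2 * π * (i : ℕ) / n)) - f (m * (2 * π * (j : ℕ) / n))) =
      adj n k i j * (cos (p * (2 * π * ((((j : ℕ) : ℤ) - (i : ℕ) : ℤ) : ℝ) / n)) *
        (f (m * (2 * π * (i : ℕ) / n)) - f (m * (2 * π * (((j : ℕ) : ℤ) : ℝ) / n)))) := by
    intro j
    push_cast
    rw [mul_assoc]
    congr 4
    ring
  rw [Finset.sum_congr rfl fun j _ => h2 j, h1, weig, Finset.mul_sum, Finset.sum_mul]
  refine Finset.sum_congr rfl fun d _ => ?_
  have e1 : (((i : ℕ) + (d : ℤ) - (i : ℕ) : ℤ) : ℝ) = d := by push_cast; ring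
  have e2 : (((i : ℕ) - (d : ℤ) - (i : ℕ) : ℤ) : ℝ) = -d := by push_cast; ring
  have e3 : (m : ℝ) * (2 * π * (((i : ℕ) + (d : ℤ) : ℤ) : ℝ) / n) =
      m * (2 * π * (i : ℕ) / n) + m * (2 * π * d / n) := by push_cast; ring
  have e4 : (m : ℝ) * (2 * π * (((i : ℕ) - (d : ℤ) : ℤ) : ℝ) / n) =
      m * (2 * π * (i : ℕ) / n) - m * (2 * π * d / n) := by push_cast; ring
  have e5 : (p : ℝ) * (2 * π * -(d : ℝ) / n) = -(p * (2 * π * d / n)) := by ring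
  rw [e1, e2, e3, e4, e5, Real.cos_neg]
  linear_combination (-cos (p * (2 * π * d / n))) *
    hadd (m * (2 * π * (i : ℕ) / n)) (m * (2 * π * d / n))

theorem wlap_cosMode {n k : ℕ} (h : Admissible n k) (p m : ℕ) :
    wlap n k p (cosMode n m) = weig n k p m • cosMode n m :=
  wlap_mode h p m cos Real.cos_periodic fun x y => by rw [cos_add, cos_sub]; ring

theorem wlap_sinMode {n k : ℕ} (h : Admissible n k) (p m : ℕ) :
    wlap n k p (sinMode n m) = weig n k p m • sinMode n m :=
  wlap_mode h p m sin Real.sin_periodic fun x y => by rw [sin_add, sin_sub]; ring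

/-- Averaging over the exchange of i and j, under which the weights are invariant because cosine is
even. Self-adjointness and the quadratic form are read off from it. -/
theorem dotProduct_wlap (n k p : ℕ) (u v : Fin n → ℝ) :
    2 * (u ⬝ᵥ wlap n k p v) = ∑ i, ∑ j, adj n k i j *
      cos (p * (2 * π * (j : ℕ) / n - 2 * π * (i : ℕ) / n)) * ((u j - u i) * (v j - v i)) := by
  have h1 : u ⬝ᵥ wlap n k p v = ∑ i, ∑ j, adj n k i j *
      cos (p * (2 * π * (j : ℕ) / n - 2 * π * (i : ℕ) / n)) * (u i * (v i - v j)) := by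
    simp only [dotProduct, wlap, Finset.mul_sum]
    exact Finset.sum_congr rfl fun i _ => Finset.sum_congr rfl fun j _ => by ring
  have h2 : u ⬝ᵥ wlap n k p v = ∑ i, ∑ j, adj n k i j *
      cos (p * (2 * π * (j : ℕ) / n - 2 * π * (i : ℕ) / n)) * (u j * (v j - v i)) := by
    rw [h1, Finset.sum_comm]
    refine Finset.sum_congr rfl fun i _ => Finset.sum_congr rfl fun j _ => ?_
    rw [adj_symm n k j i, ← Real.cos_neg]
    congr 3
    ring
  rw [two_mul]
  nth_rw 1 [h1]
  rw [h2, ← Finset.sum_add_distrib]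
  refine Finset.sum_congr rfl fun i _ => ?_
  rw [← Finset.sum_add_distrib]
  exact Finset.sum_congr rfl fun j _ => by ring

theorem wlap_selfAdjoint (n k p : ℕ) (u v : Fin n → ℝ) :
    u ⬝ᵥ wlap n k p v = wlap n k p u ⬝ᵥ v := by
  have h1 := dotProduct_wlap n k p u v
  have h2 := dotProduct_wlap n k p v u
  rw [dotProduct_comm _ v]
  have : ∀ i j, (u j - u i) * (v j - v i) = (v j - v i) * (u j - u i) := fun i j => mul_comm _ _
  simp_rw [this] at h1
  linarith

theorem cosMode_dotProduct_wlap {n k : ℕ} (h : Admissible n k) (p m : ℕ) (u : Fin n → ℝ) :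
    cosMode n m ⬝ᵥ wlap n k p u = weig n k p m * (cosMode n m ⬝ᵥ u) := by
  rw [wlap_selfAdjoint, wlap_cosMode h, smul_dotProduct, smul_eq_mul]

theorem sinMode_dotProduct_wlap {n k : ℕ} (h : Admissible n k) (p m : ℕ) (u : Fin n → ℝ) :
    sinMode n m ⬝ᵥ wlap n k p u = weig n k p m * (sinMode n m ⬝ᵥ u) := by
  rw [wlap_selfAdjoint, wlap_sinMode h, smul_dotProduct, smul_eq_mul]

/-- The spectral gap of the weighted Laplacian on vectors of mean zero. -/
theorem le_dotProduct_wlap {n k : ℕ} (h : Admissible n k) (p : ℕ) (γ : ℝ)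
    (hγ : ∀ m : ℕ, 1 ≤ m → m < n → γ ≤ weig n k p m) (u : Fin n → ℝ) (hu : ∑ i, u i = 0) :
    γ * (u ⬝ᵥ u) ≤ u ⬝ᵥ wlap n k p u := by
  have hn : (0 : ℝ) < n := by
    have := h.2
    have : 0 < n := by omega
    exact_mod_cast this
  have h1 := sum_modes_mul u u
  have h2 := sum_modes_mul u (wlap n k p u)
  refine le_of_mul_le_mul_left ?_ hn
  rw [← h2, mul_left_comm, ← h1, Finset.mul_sum]
  refine Finset.sum_le_sum fun m hm => ?_
  rw [cosMode_dotProduct_wlap h, sinMode_dotProduct_wlap h]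
  -- Mean zero kills the coefficient of the constant mode, the only one not controlled by γ.
  rcases Nat.eq_zero_or_pos m with rfl | hm0
  · have e1 : cosMode n 0 ⬝ᵥ u = 0 := by simpa [cosMode, dotProduct] using hu
    have e2 : sinMode n 0 ⬝ᵥ u = 0 := by simp [sinMode, dotProduct]
    simp [e1, e2]
  · have := hγ m hm0 (Finset.mem_range.1 hm)
    nlinarith [mul_nonneg (sub_nonneg.2 this) (mul_self_nonneg (cosMode n m ⬝ᵥ u)),
      mul_nonneg (sub_nonneg.2 this) (mul_self_nonneg (sinMode n m ⬝ᵥ u))]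

/-! ### The Laplacian eigenvalues in closed form -/

/-- The eigenvalue of the graph Laplacian at the Fourier mode `m`. -/
noncomputable def lam (n k : ℕ) (m : ℝ) : ℝ := weig n k 0 m

theorem lam_eq_sum (n k : ℕ) (m : ℝ) :
    lam n k m = 2 * ∑ d ∈ Finset.Icc 1 k, (1 - cos (m * (2 * π * d / n))) := by
  simp [lam, weig]

theorem lam_zero (n k : ℕ) : lam n k 0 = 0 := by
  simp [lam_eq_sum]

/-- Product-to-sum for cos a · cos(m a). This is the bridge from stability of the twisted state to
the Laplacian spectrum. -/
theorem weig_one (n k : ℕ) (m : ℝ) :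
    weig n k 1 m = (lam n k (m + 1) + lam n k (m - 1)) / 2 - lam n k 1 := by
  simp only [weig, lam_eq_sum]
  rw [← mul_add, ← Finset.sum_add_distrib, mul_div_assoc, Finset.sum_div, ← mul_sub,
    ← Finset.sum_sub_distrib]
  congr 1
  refine Finset.sum_congr rfl fun d _ => ?_
  rw [add_mul, sub_mul, cos_add, cos_sub, one_mul]
  ring

theorem sin_mul_lam (n k : ℕ) (m : ℝ) :
    sin (m * (π / n)) * lam n k m =
      (2 * k + 1) * sin (m * (π / n)) - sin ((2 * k + 1) * (m * (π / n))) := by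
  rw [← sin_mul_sum_cos, lam_eq_sum, Finset.sum_sub_distrib]
  have h : ∀ d : ℕ, 2 * (d : ℝ) * (m * (π / n)) = m * (2 * π * d / n) := fun d => by ring
  simp_rw [h]
  simp only [sum_const, Nat.card_Icc, add_tsub_cancel_right, nsmul_eq_mul, mul_one]
  ring

/-- Modes m and n - m are complex conjugates; this lets later estimates assume 2m ≤ n, where m x
stays in the first quadrant. -/
theorem lam_reflect {n : ℕ} (k : ℕ) (hn : n ≠ 0) (m : ℝ) : lam n k (n - m) = lam n k m := by
  have hn' : (n : ℝ) ≠ 0 := by exact_mod_cast hn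
  simp only [lam_eq_sum]
  congr 1
  refine Finset.sum_congr rfl fun d _ => ?_
  have : ((n : ℝ) - m) * (2 * π * d / n) = d * (2 * π) - m * (2 * π * d / n) := by
    field_simp
  rw [this, Real.cos_nat_mul_two_pi_sub]

section Angles

variable {n : ℕ}

theorem angle_pos (hn : 0 < n) : 0 < π / n := by positivity

theorem natCast_mul_angle_le {m : ℕ} (hn : 0 < n) (c : ℝ) (h : (m : ℝ) ≤ c * n) :
    m * (π / n) ≤ c * π := by
  have hn' : (0 : ℝ) < n := by exact_mod_cast hn
  rw [mul_div_assoc', div_le_iff₀ hn']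
  nlinarith [Real.pi_pos]

theorem le_natCast_mul_angle {m : ℕ} (hn : 0 < n) (c : ℝ) (h : c * n ≤ (m : ℝ)) :
    c * π ≤ m * (π / n) := by
  have hn' : (0 : ℝ) < n := by exact_mod_cast hn
  rw [mul_div_assoc', le_div_iff₀ hn']
  nlinarith [Real.pi_pos]

theorem sin_natCast_mul_angle_pos {m : ℕ} (hm : 1 ≤ m) (hmn : m < n) : 0 < sin (m * (π / n)) := by
  have hn : 0 < n := by omega
  have hn' : (0 : ℝ) < n := by exact_mod_cast hn
  have hm' : (0 : ℝ) < m := by exact_mod_cast hm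
  apply Real.sin_pos_of_pos_of_lt_pi (by positivity)
  rw [mul_div_assoc', div_lt_iff₀ hn', mul_comm]
  exact mul_lt_mul_of_pos_left (by exact_mod_cast hmn) Real.pi_pos

end Angles

theorem lam_eq {n : ℕ} (k : ℕ) {m : ℕ} (hm : 1 ≤ m) (hmn : m < n) :
    lam n k m = (2 * k + 1) - sin ((2 * k + 1) * (m * (π / n))) / sin (m * (π / n)) := by
  have h := sin_natCast_mul_angle_pos hm hmn
  have := sin_mul_lam n k m
  rw [eq_sub_iff_add_eq, ← eq_sub_iff_add_eq', div_eq_iff h.ne']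
  linarith

theorem lam_pos {n k : ℕ} (h : Admissible n k) {m : ℕ} (hm : 1 ≤ m) (hmn : m < n) :
    0 < lam n k m := by
  rw [lam_eq_sum]
  have h1 : (1 - cos (m * (2 * π * (1 : ℕ) / n))) ≤
      ∑ d ∈ Finset.Icc 1 k, (1 - cos (m * (2 * π * d / n))) :=
    Finset.single_le_sum (f := fun d : ℕ => 1 - cos ((m : ℝ) * (2 * π * d / n)))
      (fun d _ => sub_nonneg.2 (cos_le_one _)) (Finset.mem_Icc.2 ⟨le_rfl, h.1⟩)
  have h2 := sin_natCast_mul_angle_pos hm hmn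
  have h3 : (m : ℝ) * (2 * π * (1 : ℕ) / n) = 2 * (m * (π / n)) := by push_cast; ring
  rw [h3, Real.cos_two_mul] at h1
  nlinarith [Real.sin_sq_add_cos_sq ((m : ℝ) * (π / n))]

/-! ### The smallest nonzero eigenvalue -/

/-- The quotient sin(rt)/sin t decreases in t: it satisfies Q_{r+1}(t) = cos t · Q_r(t) + cos(rt),
and both cosines decrease. The denominators are multiplied out. -/
theorem sin_nat_mul_mul_sin_le (r : ℕ) {s t : ℝ} (hs : 0 < s) (hst : s ≤ t) (ht : t ≤ π / 2)
    (hr : r * t ≤ π) : sin (r * t) * sin s ≤ sin (r * s) * sin t := by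
  induction r with
  | zero => simp
  | succ r ih =>
    push_cast at hr ⊢
    have ht0 : 0 < t := hs.trans_le hst
    have hrt : (r : ℝ) * t ≤ π := by nlinarith
    have ih := ih hrt
    have hc : cos t ≤ cos s := cos_le_cos_of_nonneg_of_le_pi hs.le (by linarith) hst
    have hct : 0 ≤ cos t := cos_nonneg_of_neg_pi_div_two_le_of_le (by linarith) ht
    have hrs : (r : ℝ) * s ≤ r * t := by gcongr
    have hrs0 : 0 ≤ (r : ℝ) * s := by positivity
    have hcr : cos (r * t) ≤ cos (r * s) := cos_le_cos_of_nonneg_of_le_pi hrs0 hrt hrs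
    have hss : 0 ≤ sin s := sin_nonneg_of_nonneg_of_le_pi hs.le (by linarith)
    have hsst : 0 ≤ sin t := sin_nonneg_of_nonneg_of_le_pi ht0.le (by linarith)
    have hsr : 0 ≤ sin (r * s) := sin_nonneg_of_nonneg_of_le_pi hrs0 (by linarith)
    rw [add_mul, add_mul, one_mul, one_mul, sin_add, sin_add]
    have h1 := mul_le_mul_of_nonneg_left ih hct
    have h2 := mul_le_mul_of_nonneg_right hc (mul_nonneg hsr hsst)
    have h3 := mul_le_mul_of_nonneg_right hcr (mul_nonneg hss hsst)
    nlinarith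

theorem sin_nat_mul_mul_sin_lt (r : ℕ) (h2 : 2 ≤ r) {s t : ℝ} (hs : 0 < s) (hst : s < t)
    (ht : t ≤ π / 2) (hr : r * t ≤ π) : sin (r * t) * sin s < sin (r * s) * sin t := by
  obtain ⟨r, rfl⟩ : ∃ r', r = r' + 1 := ⟨r - 1, by omega⟩
  push_cast at hr ⊢
  have hr1 : (1 : ℝ) ≤ r := by exact_mod_cast (by omega : 1 ≤ r)
  have ht0 : 0 < t := hs.trans hst
  have hrt : (r : ℝ) * t ≤ π := by nlinarith
  have ih := sin_nat_mul_mul_sin_le r hs hst.le ht hrt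
  have hc : cos t ≤ cos s := cos_le_cos_of_nonneg_of_le_pi hs.le (by linarith) hst.le
  have hct : 0 ≤ cos t := cos_nonneg_of_neg_pi_div_two_le_of_le (by linarith) ht
  have hrs : (r : ℝ) * s < r * t := by gcongr
  have hrs0 : 0 ≤ (r : ℝ) * s := by positivity
  have hcr : cos (r * t) < cos (r * s) := cos_lt_cos_of_nonneg_of_le_pi hrs0 hrt hrs
  have hss : 0 < sin s := sin_pos_of_pos_of_lt_pi hs (by linarith)
  have hsst : 0 < sin t := sin_pos_of_pos_of_lt_pi ht0 (by linarith)
  have hsr : 0 ≤ sin (r * s) := sin_nonneg_of_nonneg_of_le_pi hrs0 (by linarith)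
  rw [add_mul, add_mul, one_mul, one_mul, sin_add, sin_add]
  have h1 := mul_le_mul_of_nonneg_left ih hct
  have h2 := mul_le_mul_of_nonneg_right hc (mul_nonneg hsr hsst.le)
  -- The strict gain comes from cos(rt) < cos(rs), which needs the shifted index r to be at least 1.
  have h3 := mul_lt_mul_of_pos_right hcr (mul_pos hss hsst)
  nlinarith

/-- Jordan's bound sin z ≥ 2z/π makes the product at least 4rm/n² ≥ 4/n, which exceeds π/n. -/
theorem sin_angle_lt_mul {n r m : ℕ} (hn : 0 < n) (hr : 2 * r ≤ n) (hm : 2 * m ≤ n)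
    (hrm : n ≤ r * m) : sin (π / n) < sin (r * (π / n)) * sin (m * (π / n)) := by
  have hx := angle_pos hn
  have hn' : (0 : ℝ) < n := by exact_mod_cast hn
  have hr' : (r : ℝ) * (π / n) ≤ π / 2 := by
    have := natCast_mul_angle_le (m := r) hn (1 / 2) (by
      have : (2 : ℝ) * r ≤ n := by exact_mod_cast hr
      linarith)
    linarith
  have hm' : (m : ℝ) * (π / n) ≤ π / 2 := by
    have := natCast_mul_angle_le (m := m) hn (1 / 2) (by
      have : (2 : ℝ) * m ≤ n := by exact_mod_cast hm
      linarith)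
    linarith
  have h1 := Real.mul_le_sin (by positivity) hr'
  have h2 := Real.mul_le_sin (by positivity) hm'
  have h3 : sin (π / n) < π / n := Real.sin_lt hx
  have h4 : π / n < (2 / π * (r * (π / n))) * (2 / π * (m * (π / n))) := by
    have e : (2 / π * (r * (π / n))) * (2 / π * (m * (π / n))) = 4 * (r * m) / (n * n) := by
      field_simp; ring
    have hc : (n : ℝ) ≤ r * m := by exact_mod_cast hrm
    rw [e, div_lt_div_iff₀ hn' (by positivity)]
    have : π * n < 4 * (r * m) := by nlinarith [Real.pi_lt_four]
    nlinarith
  calc sin (π / n) < _ := h3.trans h4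
    _ ≤ _ := mul_le_mul h1 h2 (by positivity) ((by positivity : (0:ℝ) ≤ _).trans h1)

/-- For rm ≤ n the argument of the left sine stays within [0, π] and monotonicity of sin(rt)/sin t
applies; for rm > n the crude bound |sin| ≤ 1 already suffices. -/
theorem abs_sin_mul_sin_angle_lt {n r m : ℕ} (hr2 : 2 ≤ r) (hr : 2 * r ≤ n) (hm2 : 2 ≤ m)
    (hm : 2 * m ≤ n) :
    |sin (r * (m * (π / n)))| * sin (π / n) < sin (r * (π / n)) * sin (m * (π / n)) := by
  have hn : 0 < n := by omega
  have hx := angle_pos hn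
  have hsx : 0 < sin (π / n) := by
    simpa using sin_natCast_mul_angle_pos (n := n) (m := 1) le_rfl (by omega)
  by_cases hrm : r * m ≤ n
  · have hle : (r : ℝ) * (m * (π / n)) ≤ π := by
      have := natCast_mul_angle_le (m := r * m) hn 1 (by rw [one_mul]; exact_mod_cast hrm)
      push_cast at this
      linarith
    rw [abs_of_nonneg (sin_nonneg_of_nonneg_of_le_pi (by positivity) hle)]
    refine sin_nat_mul_mul_sin_lt r hr2 hx ?_ ?_ hle
    · have : (1 : ℝ) < m := by exact_mod_cast hm2
      nlinarith
    · have := natCast_mul_angle_le (m := m) hn (1 / 2) (by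
        have : (2 : ℝ) * m ≤ n := by exact_mod_cast hm
        linarith)
      linarith
  · refine lt_of_le_of_lt ?_ (sin_angle_lt_mul hn hr hm (by omega))
    nlinarith [abs_sin_le_one (r * (m * (π / n)))]

theorem abs_sin_mul_sin_angle_le {n r m : ℕ} (hr : 2 * r ≤ n) (hm1 : 1 ≤ m)
    (hm : 2 * m ≤ n) :
    |sin (r * (m * (π / n)))| * sin (π / n) ≤ sin (r * (π / n)) * sin (m * (π / n)) := by
  have hn : 0 < n := by omega
  have hx := angle_pos hn
  have hsm := sin_natCast_mul_angle_pos (n := n) (m := m) hm1 (by omega)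
  have hsr : 0 ≤ sin (r * (π / n)) := by
    rcases Nat.eq_zero_or_pos r with rfl | h0
    · simp
    · exact (sin_natCast_mul_angle_pos h0 (by omega)).le
  by_cases h : 2 ≤ r ∧ 2 ≤ m
  · exact (abs_sin_mul_sin_angle_lt h.1 hr h.2 hm).le
  · have hcases : r = 0 ∨ r = 1 ∨ m = 1 := by omega
    rcases hcases with rfl | rfl | rfl
    · simp
    · simp only [Nat.cast_one, one_mul] at *
      rw [abs_of_pos hsm, mul_comm]
    · simp only [Nat.cast_one, one_mul] at *
      rw [abs_of_nonneg hsr]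

theorem abs_sin_complement {n r q : ℕ} (m : ℕ) (hn : 0 < n) (h : r + q = n) :
    |sin (q * (m * (π / n)))| = |sin (r * (m * (π / n)))| := by
  have hn' : (n : ℝ) ≠ 0 := by positivity
  have e : (q : ℝ) * (m * (π / n)) = m * π - r * (m * (π / n)) := by
    have : (n : ℝ) = r + q := by exact_mod_cast h.symm
    have hq : (q : ℝ) = n - r := by linarith
    rw [hq]; field_simp
  rw [e, Real.sin_nat_mul_pi_sub, abs_neg, abs_mul, abs_pow, abs_neg, abs_one, one_pow, one_mul]

theorem sin_complement {n r q : ℕ} (hn : 0 < n) (h : r + q = n) :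
    sin (q * (π / n)) = sin (r * (π / n)) := by
  have hn' : (n : ℝ) ≠ 0 := by positivity
  have e : (q : ℝ) * (π / n) = π - r * (π / n) := by
    have : (n : ℝ) = r + q := by exact_mod_cast h.symm
    have hq : (q : ℝ) = n - r := by linarith
    rw [hq]; field_simp
  rw [e, Real.sin_pi_sub]

/-- The claim compares sin(q m x)/sin(m x) with its value at m = 1. Replacing q by n - q changes
these sines at most in sign, and not at all for m = 1, so q may be taken to be at most n/2. -/
theorem lam_one_le {n k : ℕ} (h : Admissible n k) {m : ℕ} (hm : 1 ≤ m) (hmn : m < n) :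
    lam n k 1 ≤ lam n k m := by
  obtain ⟨hk, hnk⟩ := h
  have hn : 0 < n := by omega
  wlog hm2 : 2 * m ≤ n generalizing m
  · have := this (m := n - m) (by omega) (by omega) (by omega)
    rwa [Nat.cast_sub hmn.le, lam_reflect k hn.ne'] at this
  have h1 := lam_eq k hm hmn
  have h2 := lam_eq (n := n) k (m := 1) le_rfl (by omega)
  have s1 := sin_natCast_mul_angle_pos hm hmn
  have s2 := sin_natCast_mul_angle_pos (n := n) (m := 1) le_rfl (by omega)
  simp only [Nat.cast_one, one_mul] at h2 s2
  have hq : (2 * (k : ℝ) + 1) = ((2 * k + 1 : ℕ) : ℝ) := by push_cast; ring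
  rw [h1, h2, sub_le_sub_iff_left, div_le_div_iff₀ s1 s2, hq]
  refine (mul_le_mul_of_nonneg_right (le_abs_self _) s2.le).trans ?_
  by_cases hc : 2 * (2 * k + 1) ≤ n
  · exact abs_sin_mul_sin_angle_le hc hm hm2
  · have hr : n - (2 * k + 1) + (2 * k + 1) = n := by omega
    rw [abs_sin_complement m hn hr, sin_complement hn hr]
    exact abs_sin_mul_sin_angle_le (by omega) hm hm2

/-- The gap leaves n - (2k+1) ≥ 2. Without it strictness can fail: for n = 2k+1 all nonzero
eigenvalues coincide, and for n = 2k+2 those of odd index do. -/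
theorem lam_one_lt {n k : ℕ} (h : Admissible n k) (hgap : 2 * k + 3 ≤ n) {m : ℕ} (hm : 2 ≤ m)
    (hmn : m + 2 ≤ n) : lam n k 1 < lam n k m := by
  obtain ⟨hk, hnk⟩ := h
  have hn : 0 < n := by omega
  wlog hm2 : 2 * m ≤ n generalizing m
  · have := this (m := n - m) (by omega) (by omega) (by omega)
    rwa [Nat.cast_sub (by omega), lam_reflect k hn.ne'] at this
  have h1 := lam_eq (n := n) k (m := m) (by omega) (by omega)
  have h2 := lam_eq (n := n) k (m := 1) le_rfl (by omega)
  have s1 := sin_natCast_mul_angle_pos (n := n) (m := m) (by omega) (by omega)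
  have s2 := sin_natCast_mul_angle_pos (n := n) (m := 1) le_rfl (by omega)
  simp only [Nat.cast_one, one_mul] at h2 s2
  have hq : (2 * (k : ℝ) + 1) = ((2 * k + 1 : ℕ) : ℝ) := by push_cast; ring
  rw [h1, h2, sub_lt_sub_iff_left, div_lt_div_iff₀ s1 s2, hq]
  refine (mul_le_mul_of_nonneg_right (le_abs_self _) s2.le).trans_lt ?_
  by_cases hc : 2 * (2 * k + 1) ≤ n
  · exact abs_sin_mul_sin_angle_lt (by omega) hc hm hm2
  · have hr : n - (2 * k + 1) + (2 * k + 1) = n := by omega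
    rw [abs_sin_complement m hn hr, sin_complement hn hr]
    exact abs_sin_mul_sin_angle_lt (by omega) (by omega) hm hm2

/-! ### Comparison of the eigenvalues at different densities -/

theorem two_mul_lam_one_lt_of_le {n k : ℕ} (h : Admissible n k)
    (hd : (2 * k + 1 : ℝ) ≤ 0.6 * n) : 2 * lam n k 1 < lam n k 2 := by
  obtain ⟨hk, hnk⟩ := h
  have hn : 0 < n := by omega
  have hn' : (0 : ℝ) < n := by exact_mod_cast hn
  -- If edges span less than a quarter turn, all weights are positive and w(1) > 0 termwise.
  -- Otherwise y = q x lies in [π/2, 0.6π], where sin 2y ≤ 0 gives λ(2) ≥ q, and q sin x ≤ y < 2 sin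
  -- y gives 2λ(1) < q.
  by_cases hc : 2 * (2 * k + 1) ≤ n
  · have hw := weig_one n k 1
    have e : (1 : ℝ) + 1 = 2 := by norm_num
    rw [e, sub_self, lam_zero, add_zero] at hw
    have : 0 < weig n k 1 1 := by
      refine mul_pos two_pos (Finset.sum_pos (fun d hd => ?_) ⟨1, by simp [hk]⟩)
      rw [Finset.mem_Icc] at hd
      have hd1 : (1 : ℝ) ≤ d := by exact_mod_cast hd.1
      have hd2 : (2 * d : ℝ) < n / 2 := by
        have : 2 * (2 * d) < n := by omega
        have : (2 : ℝ) * (2 * d) < n := by exact_mod_cast this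
        linarith
      have hlt : 1 * (2 * π * d / n) < π / 2 := by
        rw [one_mul, div_lt_iff₀ hn']
        nlinarith [Real.pi_pos]
      have hpos : 0 < 1 * (2 * π * d / n) := by positivity
      refine mul_pos (cos_pos_of_mem_Ioo ⟨by linarith, hlt⟩) (sub_pos.2 ?_)
      have := cos_lt_cos_of_nonneg_of_le_pi (le_refl 0) (by linarith) hpos
      rwa [cos_zero] at this
    linarith
  · set x := π / n with hx
    have hx0 : 0 < x := angle_pos hn
    have hq : (2 * (k : ℝ) + 1) = ((2 * k + 1 : ℕ) : ℝ) := by push_cast; ring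
    have hy1 : (2 * (k : ℝ) + 1) * x ≤ 0.6 * π := by
      rw [hq]; exact natCast_mul_angle_le hn _ (by rw [← hq]; exact hd)
    have hy2 : 1 / 2 * π ≤ (2 * (k : ℝ) + 1) * x := by
      rw [hq]
      refine le_natCast_mul_angle hn _ ?_
      have : n ≤ 2 * (2 * k + 1) := by omega
      have : (n : ℝ) ≤ 2 * ((2 * k + 1 : ℕ) : ℝ) := by exact_mod_cast this
      linarith
    have h1 := lam_eq (n := n) k (m := 1) le_rfl (by omega)
    have h2 := lam_eq (n := n) k (m := 2) (by omega) (by omega)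
    have s1 := sin_natCast_mul_angle_pos (n := n) (m := 1) le_rfl (by omega)
    have s2 := sin_natCast_mul_angle_pos (n := n) (m := 2) (by omega) (by omega)
    simp only [Nat.cast_one, one_mul, Nat.cast_ofNat, ← hx] at h1 h2 s1 s2
    set y := (2 * (k : ℝ) + 1) * x with hy
    have e2 : (2 * (k : ℝ) + 1) * (2 * x) = 2 * y := by rw [hy]; ring
    rw [e2] at h2
    have hpi := Real.pi_lt_d2
    have hpi0 := Real.pi_pos
    have hs2 : sin (2 * y) ≤ 0 := by
      rw [sin_two_mul]
      have c1 : cos y ≤ 0 := cos_nonpos_of_pi_div_two_le_of_le (by linarith) (by linarith)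
      have c2 : 0 ≤ sin y := sin_nonneg_of_nonneg_of_le_pi (by linarith) (by linarith)
      nlinarith
    have hsy : y < 2 * sin y := by
      have a1 : sin y = cos (y - π / 2) := by rw [Real.cos_sub_pi_div_two]
      have a2 := Real.one_sub_sq_div_two_le_cos (x := y - π / 2)
      rw [a1]
      nlinarith
    have hmain : 2 * (k : ℝ) + 1 < 2 * (sin y / sin x) := by
      have : sin x ≤ x := Real.sin_le hx0.le
      rw [mul_div_assoc', lt_div_iff₀ s1]
      calc (2 * (k : ℝ) + 1) * sin x ≤ (2 * (k : ℝ) + 1) * x := by gcongr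
        _ < 2 * sin y := hsy
    have hneg : sin (2 * y) / sin (2 * x) ≤ 0 := div_nonpos_of_nonpos_of_nonneg hs2 s2.le
    rw [h1, h2]
    linarith

theorem lt_sin_pi_div_five : 0.55 < sin (0.2 * π) := by
  have h1 := Real.pi_gt_d2
  have h2 := Real.pi_lt_d2
  have h3 := Real.sin_gt_sub_cube (x := 0.2 * π) (by linarith)
  nlinarith [pow_le_pow_left₀ (by linarith) (by linarith : 0.2 * π ≤ 0.63) 3]

/-- Disposes of all modes from a up to n/2 at once, whatever the numerator. -/
theorem abs_sin_div_sin_le {n m a : ℕ} (ha : 1 ≤ a) (ham : a ≤ m) (hm : 2 * m ≤ n) (z : ℝ) :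
    |sin z / sin (m * (π / n))| ≤ 1 / sin (a * (π / n)) := by
  have hn : 0 < n := by omega
  have hx := angle_pos hn
  have s1 := sin_natCast_mul_angle_pos (n := n) (m := m) (by omega) (by omega)
  have s2 := sin_natCast_mul_angle_pos (n := n) (m := a) (by omega) (by omega)
  have hmono : sin (a * (π / n)) ≤ sin (m * (π / n)) := by
    have hle : (m : ℝ) * (π / n) ≤ 1 / 2 * π := natCast_mul_angle_le hn _ (by
        have : (2 : ℝ) * m ≤ n := by exact_mod_cast hm
        linarith)
    have h0 : 0 ≤ (a : ℝ) * (π / n) := by positivity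
    apply Real.sin_le_sin_of_le_of_le_pi_div_two (by linarith [Real.pi_pos]) (by linarith)
    gcongr
  rw [abs_div, abs_of_pos s1]
  exact div_le_div₀ zero_le_one (abs_sin_le_one z) s2 hmono

theorem lam_le_lam_two {n k : ℕ} (hn : 20 ≤ n)
    (hd1 : 0.6 * n ≤ (2 * k + 1 : ℝ)) (hd2 : (2 * k + 1 : ℝ) ≤ 0.7 * n) {m : ℕ} (hm : 1 ≤ m)
    (hmn : m < n) : lam n k m ≤ lam n k 2 := by
  have hn0 : 0 < n := by omega
  have hn' : (20 : ℝ) ≤ n := by exact_mod_cast hn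
  wlog hm2 : 2 * m ≤ n generalizing m
  · have := this (m := n - m) (by omega) (by omega) (by omega)
    rwa [Nat.cast_sub hmn.le, lam_reflect k hn0.ne'] at this
  rcases eq_or_ne m 2 with rfl | hne
  · exact le_rfl
  set x := π / n with hx
  have hx0 : 0 < x := angle_pos hn0
  have hpi := Real.pi_lt_d2
  have hpi' := Real.pi_gt_d2
  have hx1 : x ≤ 0.1575 := by
    rw [hx, div_le_iff₀ (by linarith)]; linarith
  have hq : (2 * (k : ℝ) + 1) = ((2 * k + 1 : ℕ) : ℝ) := by push_cast; ring
  have hy1 : (2 * (k : ℝ) + 1) * x ≤ 0.7 * π := by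
    rw [hq]; exact natCast_mul_angle_le hn0 _ (by rw [← hq]; exact hd2)
  have hy2 : 0.6 * π ≤ (2 * (k : ℝ) + 1) * x := by
    rw [hq]; exact le_natCast_mul_angle hn0 _ (by rw [← hq]; exact hd1)
  have h1 := lam_eq k hm hmn
  have h2 := lam_eq (n := n) k (m := 2) (by omega) (by omega)
  have s1 := sin_natCast_mul_angle_pos hm hmn
  have s2 := sin_natCast_mul_angle_pos (n := n) (m := 2) (by omega) (by omega)
  simp only [Nat.cast_ofNat, ← hx] at h1 h2 s1 s2
  have habs := abs_sin_div_sin_le (a := 4) (n := n) (m := m) (by omega)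
  set y := (2 * (k : ℝ) + 1) * x with hy
  have e2 : (2 * (k : ℝ) + 1) * (2 * x) = 2 * y := by rw [hy]; ring
  have em : (2 * (k : ℝ) + 1) * (m * x) = m * y := by rw [hy]; ring
  rw [e2] at h2
  rw [em] at h1
  have hs5 := lt_sin_pi_div_five
  -- 2y lies in [1.2π, 1.4π], so mode 2 has a markedly negative numerator; the other modes need only
  -- have a quotient no smaller than -sin(0.2π)/sin 2x.
  have hneg : sin (2 * y) ≤ - sin (0.2 * π) := by
    have : sin (2 * y) = - sin (2 * y - π) := by rw [Real.sin_sub_pi, neg_neg]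
    rw [this, neg_le_neg_iff]
    exact Real.sin_le_sin_of_le_of_le_pi_div_two (by linarith) (by linarith) (by linarith)
  rw [h1, h2, sub_le_sub_iff_left]
  have key : sin (2 * y) / sin (2 * x) ≤ - (sin (0.2 * π) / sin (2 * x)) := by
    rw [← neg_div]; gcongr
  rcases (show m = 1 ∨ m = 3 ∨ 4 ≤ m by omega) with rfl | rfl | h4
  · have : 0 ≤ sin (((1 : ℕ) : ℝ) * y) / sin (((1 : ℕ) : ℝ) * x) :=
      div_nonneg (sin_nonneg_of_nonneg_of_le_pi (by push_cast; linarith) (by push_cast; linarith))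
        s1.le
    have : 0 ≤ sin (0.2 * π) / sin (2 * x) := div_nonneg (by linarith) s2.le
    linarith
  · push_cast at *
    refine key.trans ?_
    have a1 : sin (2 * x) ≤ sin (3 * x) :=
      Real.sin_le_sin_of_le_of_le_pi_div_two (by linarith) (by linarith) (by linarith)
    have a2 : - sin (0.2 * π) ≤ sin (3 * y) := by
      rw [← Real.sin_neg, ← Real.sin_sub_two_pi (3 * y)]
      exact Real.sin_le_sin_of_le_of_le_pi_div_two (by linarith) (by linarith) (by linarith)
    have a3 : sin (0.2 * π) / sin (3 * x) ≤ sin (0.2 * π) / sin (2 * x) := by gcongr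
    have a4 : - (sin (0.2 * π) / sin (3 * x)) ≤ sin (3 * y) / sin (3 * x) := by
      rw [← neg_div]; gcongr
    linarith
  · refine key.trans ?_
    have a1 := habs h4 hm2 (m * y)
    have a2 := neg_le_of_abs_le a1
    refine le_trans (neg_le_neg ?_) a2
    push_cast
    -- sin 4x = 2 sin 2x cos 2x reduces the claim to 1/(2 cos 2x) ≤ 0.55 < sin(0.2π), which holds
    -- because x ≤ 0.1575.
    rw [show (4 : ℝ) * (π / n) = 2 * (2 * x) by rw [hx]; ring, sin_two_mul]
    have hc : 1 / (2 * 0.55) ≤ cos (2 * x) := by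
      have := Real.one_sub_sq_div_two_le_cos (x := 2 * x)
      norm_num at this ⊢
      nlinarith
    norm_num at hc
    rw [div_le_div_iff₀ (by positivity) s2]
    nlinarith [mul_le_mul hs5.le hc (by norm_num) (by linarith)]

theorem lam_le_two_mul_lam_one {n k : ℕ} (hn : 40 ≤ n) (h : Admissible n k)
    (hd : 0.7 * n ≤ (2 * k + 1 : ℝ)) {m : ℕ} (hm : 1 ≤ m) (hmn : m < n) :
    lam n k m ≤ 2 * lam n k 1 := by
  have hn0 : 0 < n := by omega
  have hn' : (40 : ℝ) ≤ n := by exact_mod_cast hn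
  wlog hm2 : 2 * m ≤ n generalizing m
  · have := this (m := n - m) (by omega) (by omega) (by omega)
    rwa [Nat.cast_sub hmn.le, lam_reflect k hn0.ne'] at this
  rcases eq_or_ne m 1 with rfl | hne
  · have := lam_pos h le_rfl hmn
    push_cast at *; linarith
  set x := π / n with hx
  have hx0 : 0 < x := angle_pos hn0
  have hpi := Real.pi_lt_d2
  have hpi' := Real.pi_gt_d2
  have hx1 : x ≤ 0.08 := by
    rw [hx, div_le_iff₀ (by linarith)]; linarith
  have hq : (2 * (k : ℝ) + 1) = ((2 * k + 1 : ℕ) : ℝ) := by push_cast; ring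
  have hy1 : (2 * (k : ℝ) + 1) * x ≤ π := by
    have := natCast_mul_angle_le (m := 2 * k + 1) hn0 1 (by rw [one_mul]; exact_mod_cast h.2)
    rw [← hq] at this; linarith
  have hy2 : 0.7 * π ≤ (2 * (k : ℝ) + 1) * x := by
    rw [hq]; exact le_natCast_mul_angle hn0 _ (by rw [← hq]; exact hd)
  have h1 := lam_eq k hm hmn
  have h2 := lam_eq (n := n) k (m := 1) le_rfl (by omega)
  have s2 := sin_natCast_mul_angle_pos (n := n) (m := 1) le_rfl (by omega)
  simp only [Nat.cast_one, one_mul, ← hx] at h1 h2 s2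
  have habs := neg_le_of_abs_le (abs_sin_div_sin_le (a := 2) (n := n) (m := m) (by omega)
    (by omega) hm2 ((2 * k + 1) * (m * x)))
  push_cast at habs
  rw [← hx] at habs
  set y := (2 * (k : ℝ) + 1) * x with hy
  have hsy : sin y ≤ 0.8095 := by
    have e : sin y = sin (π - y) := by rw [Real.sin_pi_sub]
    have e2 : sin (0.3 * π) = cos (π / 5) := by
      rw [← Real.cos_pi_div_two_sub]; congr 1; ring
    have e3 : sin (π - y) ≤ sin (0.3 * π) :=
      Real.sin_le_sin_of_le_of_le_pi_div_two (by linarith) (by linarith) (by linarith)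
    rw [e2, Real.cos_pi_div_five] at e3
    have : √5 ≤ 2.238 := Real.sqrt_le_iff.2 ⟨by norm_num, by norm_num⟩
    linarith
  have hsx : 0.99 * x ≤ sin x := by
    have h3 := Real.sin_gt_sub_cube hx0
    have h4 : x ^ 2 ≤ 0.06 := by nlinarith
    have h5 : x ^ 3 ≤ 0.06 * x := by nlinarith
    linarith
  have hcx : 0.99 ≤ cos x := by
    have := Real.one_sub_sq_div_two_le_cos (x := x)
    nlinarith
  rw [h1, h2]
  -- Mode m ≥ 2 contributes at worst 1/sin 2x. After multiplication by sin x the claim is 2 sin y +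
  -- 1/(2 cos x) ≤ q sin x: the left side is at most 2·0.8095 + 0.51, the right side at least
  -- 0.99·0.7π.
  suffices 2 * (sin y / sin x) + 1 / sin (2 * x) ≤ 2 * k + 1 by linarith
  have e : 2 * (sin y / sin x) + 1 / sin (2 * x) = (2 * sin y + 1 / (2 * cos x)) / sin x := by
    rw [sin_two_mul]
    have : cos x ≠ 0 := by linarith
    field_simp
  rw [e, div_le_iff₀ s2]
  have hc2 : 1 / (2 * cos x) ≤ 0.51 := by
    rw [div_le_iff₀ (by linarith)]; linarith
  have : (2 * (k : ℝ) + 1) * (0.99 * x) ≤ (2 * k + 1) * sin x := by gcongr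
  nlinarith

/-! ### The ordered eigenvalues of the graph Laplacian -/

theorem lap_mulVec (n k : ℕ) (u : Fin n → ℝ) : Matrix.mulVec (lap n k) u = wlap n k 0 u := by
  classical
  funext i
  simp only [wlap, lap, SimpleGraph.lapMatrix_mulVec_apply, adj, SimpleGraph.adjMatrix_apply]
  have h1 : ((SimpleGraph.degree (circulant n k) i : ℕ) : ℝ) * u i =
      ∑ j, (if (circulant n k).Adj i j then (1 : ℝ) else 0) * u i := by
    rw [← Finset.sum_mul, SimpleGraph.degree_eq_sum_if_adj]
  have h2 : ∑ j ∈ (circulant n k).neighborFinset i, u j =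
      ∑ j, (if (circulant n k).Adj i j then (1 : ℝ) else 0) * u j := by
    simp [SimpleGraph.neighborFinset_eq_filter, Finset.sum_filter]
  rw [h1, h2, ← Finset.sum_sub_distrib]
  refine Finset.sum_congr rfl fun j _ => ?_
  simp [mul_sub]

theorem eq_zero_of_modes {n : ℕ} (v : Fin n → ℝ)
    (h : ∀ m < n, cosMode n m ⬝ᵥ v = 0 ∧ sinMode n m ⬝ᵥ v = 0) : v = 0 := by
  rcases Nat.eq_zero_or_pos n with rfl | hn
  · exact Subsingleton.elim _ _
  have h1 := sum_modes_mul v v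
  rw [Finset.sum_eq_zero (fun m hm => by simp [h m (Finset.mem_range.1 hm)])] at h1
  have hn' : (n : ℝ) ≠ 0 := by positivity
  have h2 : v ⬝ᵥ v = 0 := by
    rcases mul_eq_zero.1 h1.symm with h | h
    · exact absurd h hn'
    · exact h
  exact dotProduct_self_eq_zero.1 h2

/-- By self-adjointness (c - λ(m)) times each mode-m coefficient of v vanishes, so if c avoided
every λ(m), Parseval would force v = 0. -/
theorem eigenvalue_eq_lam {n k : ℕ} (h : Admissible n k) {v : Fin n → ℝ} (hv : v ≠ 0) {c : ℝ}
    (hc : wlap n k 0 v = c • v) : ∃ m < n, c = lam n k m := by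
  by_contra hcon
  push Not at hcon
  refine hv (eq_zero_of_modes v fun m hm => ?_)
  have hne := hcon m hm
  have h1 := cosMode_dotProduct_wlap h 0 m v
  have h2 := sinMode_dotProduct_wlap h 0 m v
  rw [hc, dotProduct_smul, smul_eq_mul] at h1 h2
  push_cast at h1 h2
  change c ≠ weig n k 0 m at hne
  have hne' := sub_ne_zero.2 hne
  constructor
  · refine (mul_eq_zero.1 (?_ : (c - weig n k 0 m) * _ = 0)).resolve_left hne'
    linear_combination h1
  · refine (mul_eq_zero.1 (?_ : (c - weig n k 0 m) * _ = 0)).resolve_left hne'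
    linear_combination h2

theorem eq_zero_of_wlap_eq_zero {n k : ℕ} (h : Admissible n k) {v : Fin n → ℝ}
    (hv : wlap n k 0 v = 0) (hmean : ∑ i, v i = 0) : v = 0 := by
  refine eq_zero_of_modes v fun m hm => ?_
  rcases Nat.eq_zero_or_pos m with rfl | hm0
  · exact ⟨by simpa [cosMode, dotProduct] using hmean, by simp [sinMode, dotProduct]⟩
  have hpos : weig n k 0 m ≠ 0 := (lam_pos h hm0 hm).ne'
  have h1 := cosMode_dotProduct_wlap h 0 m v
  have h2 := sinMode_dotProduct_wlap h 0 m v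
  rw [hv, dotProduct_zero] at h1 h2
  push_cast at h1 h2
  exact ⟨(mul_eq_zero.1 h1.symm).resolve_left hpos, (mul_eq_zero.1 h2.symm).resolve_left hpos⟩

/-- An orthonormal family of eigenvectors for the ordered eigenvalues. -/
theorem exists_orthonormal_eigenvectors {n : ℕ} {M : Matrix (Fin n) (Fin n) ℝ} (hM : M.IsHermitian) :
    ∃ b : Fin (Fintype.card (Fin n)) → Fin n → ℝ,
      (∀ i, M.mulVec (b i) = hM.eigenvalues₀ i • b i) ∧
      ∀ i j, b i ⬝ᵥ b j = if i = j then 1 else 0 := by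
  let e : Fin (Fintype.card (Fin n)) ≃ Fin n := Fintype.equivOfCardEq (Fintype.card_fin _)
  refine ⟨fun i => (hM.eigenvectorBasis (e i)).ofLp, fun i => ?_, fun i j => ?_⟩
  · have := hM.mulVec_eigenvectorBasis (e i)
    simpa [Matrix.IsHermitian.eigenvalues, e] using this
  · have := (orthonormal_iff_ite.1 hM.eigenvectorBasis.orthonormal) (e j) (e i)
    rw [EuclideanSpace.inner_eq_star_dotProduct] at this
    simpa [eq_comm] using this

theorem exists_eigenvalues₀_eq {n : ℕ} {M : Matrix (Fin n) (Fin n) ℝ} (hM : M.IsHermitian)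
    {v : Fin n → ℝ} (hv : v ≠ 0) {c : ℝ} (hc : M.mulVec v = c • v) :
    ∃ i, hM.eigenvalues₀ i = c := by
  have h1 : Module.End.HasEigenvalue (Matrix.toLin' M) c :=
    Module.End.hasEigenvalue_of_hasEigenvector
      (Module.End.hasEigenvector_iff.2 ⟨Module.End.mem_eigenspace_iff.2 (by simpa using hc), hv⟩)
  have h2 : c ∈ spectrum ℝ M := by
    rw [← Matrix.spectrum_toLin']
    exact h1.mem_spectrum
  rw [hM.spectrum_real_eq_range_eigenvalues] at h2
  obtain ⟨i, hi⟩ := h2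
  exact ⟨_, hi⟩

theorem cosMode_ne_zero {n : ℕ} (hn : 0 < n) (m : ℕ) : cosMode n m ≠ 0 := by
  intro h
  have := congrFun h ⟨0, hn⟩
  simp [cosMode] at this

theorem exists_eigenvalues₀_eq_lam {n k : ℕ} (h : Admissible n k) (m : ℕ) :
    ∃ i, (lap_isHermitian n k).eigenvalues₀ i = lam n k m := by
  refine exists_eigenvalues₀_eq _ (cosMode_ne_zero (by have := h.2; omega) m) ?_
  rw [lap_mulVec, wlap_cosMode h]
  simp [lam]

theorem exists_lam_eq_eigenvalues₀ {n k : ℕ} (h : Admissible n k) (i) :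
    ∃ m < n, (lap_isHermitian n k).eigenvalues₀ i = lam n k m := by
  obtain ⟨b, hb, hbo⟩ := exists_orthonormal_eigenvectors (lap_isHermitian n k)
  refine eigenvalue_eq_lam h (v := b i) (fun h0 => ?_) (by rw [← lap_mulVec, hb])
  have := hbo i i
  simp [h0] at this

theorem eig_top_eq {n k : ℕ} (h : Admissible n k) :
    (∃ m, 1 ≤ m ∧ m < n ∧ eig (lap_isHermitian n k) n = lam n k m) ∧
      ∀ m : ℕ, lam n k m ≤ eig (lap_isHermitian n k) n := by
  have hn : 3 ≤ n := by have := h.1; have := h.2; omega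
  have hmax : ∀ m : ℕ, lam n k m ≤ eig (lap_isHermitian n k) n := by
    intro m
    obtain ⟨i, hi⟩ := exists_eigenvalues₀_eq_lam h m
    rw [eig, dif_pos ⟨by omega, le_rfl⟩, ← hi]
    exact (lap_isHermitian n k).eigenvalues₀_antitone (by simp [Fin.le_def])
  refine ⟨?_, hmax⟩
  have h1 := hmax 1
  have hpos := lam_pos h (m := 1) le_rfl (by omega)
  rw [eig, dif_pos ⟨by omega, le_rfl⟩] at h1 ⊢
  obtain ⟨m, hm, he⟩ := exists_lam_eq_eigenvalues₀ h ⟨n - n, by rw [Fintype.card_fin]; omega⟩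
  refine ⟨m, ?_, hm, he⟩
  rcases Nat.eq_zero_or_pos m with rfl | h0
  · rw [he, Nat.cast_zero, lam_zero] at h1
    linarith
  · exact h0

/-- In the decreasing list the last entry is λ(0) = 0, and λ(1) > 0 sits at index n - 2 or earlier.
The entry at n - 2 is some λ(m); m = 0 would mean a kernel of dimension two, and every other λ(m) is
at least λ(1). -/
theorem eig_two_eq {n k : ℕ} (h : Admissible n k) : eig (lap_isHermitian n k) 2 = lam n k 1 := by
  have hn : 3 ≤ n := by have := h.1; have := h.2; omega
  have hanti := (lap_isHermitian n k).eigenvalues₀_antitone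
  have hpos := lam_pos h (m := 1) le_rfl (by omega)
  rw [Nat.cast_one] at hpos
  rw [eig, dif_pos ⟨by omega, by omega⟩]
  set a : Fin (Fintype.card (Fin n)) := ⟨n - 2, by rw [Fintype.card_fin]; omega⟩ with ha
  set z : Fin (Fintype.card (Fin n)) := ⟨n - 1, by rw [Fintype.card_fin]; omega⟩ with hz
  have hlast : ∀ i, i ≤ z := by
    intro i
    have := i.2
    rw [Fin.le_def]
    simp only [Fintype.card_fin] at this
    simp only [hz]; omega
  have hzero : (lap_isHermitian n k).eigenvalues₀ z = 0 := by
    obtain ⟨i, hi⟩ := exists_eigenvalues₀_eq_lam h 0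
    rw [Nat.cast_zero, lam_zero] at hi
    have h1 := hanti (hlast i)
    obtain ⟨m, hm, he⟩ := exists_lam_eq_eigenvalues₀ h z
    rcases Nat.eq_zero_or_pos m with rfl | h0
    · rw [he, Nat.cast_zero, lam_zero]
    · have := lam_pos h h0 hm
      linarith
  have hle : (lap_isHermitian n k).eigenvalues₀ a ≤ lam n k 1 := by
    obtain ⟨i, hi⟩ := exists_eigenvalues₀_eq_lam h 1
    rw [Nat.cast_one] at hi
    have hne : i ≠ z := by rintro rfl; linarith
    rw [← hi]
    refine hanti ?_
    have h2 : (i : ℕ) ≠ n - 1 := fun h => hne (Fin.ext h)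
    have := i.2
    simp only [Fintype.card_fin] at this
    rw [Fin.le_def]
    simp only [ha]; omega
  refine le_antisymm hle ?_
  obtain ⟨m, hm, he⟩ := exists_lam_eq_eigenvalues₀ h a
  rcases Nat.eq_zero_or_pos m with rfl | h0
  · exfalso
    rw [Nat.cast_zero, lam_zero] at he
    obtain ⟨b, hb, hbo⟩ := exists_orthonormal_eigenvectors (lap_isHermitian n k)
    have hne : a ≠ z := by
      intro h
      have := congrArg Fin.val h
      simp only [ha, hz] at this
      omega
    have ea : wlap n k 0 (b a) = 0 := by rw [← lap_mulVec, hb, he, zero_smul]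
    have ez : wlap n k 0 (b z) = 0 := by rw [← lap_mulVec, hb, hzero, zero_smul]
    have hlin : ∀ s t : ℝ, wlap n k 0 (s • b a - t • b z) = 0 := by
      intro s t
      rw [← lap_mulVec] at ea ez ⊢
      rw [Matrix.mulVec_sub, Matrix.mulVec_smul, Matrix.mulVec_smul, ea, ez]
      simp
    -- This combination of two orthonormal null vectors has mean zero, hence vanishes; its
    -- coefficients then vanish, so `b a` itself has mean zero and is 0.
    have hcomb := eq_zero_of_wlap_eq_zero h (hlin (∑ i, b z i) (∑ i, b a i)) (by
      simp only [Pi.sub_apply, Pi.smul_apply, smul_eq_mul, Finset.sum_sub_distrib,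
        ← Finset.mul_sum]
      ring)
    have h1 := congrArg (fun v => b a ⬝ᵥ v) hcomb
    have h2 := congrArg (fun v => b z ⬝ᵥ v) hcomb
    simp only [dotProduct_sub, dotProduct_smul, hbo, dotProduct_zero, if_neg hne, if_neg hne.symm,
      if_true, smul_eq_mul] at h1 h2
    have hsum : ∑ i, b a i = 0 := by linarith
    have h0 := eq_zero_of_wlap_eq_zero h ea hsum
    have := hbo a a
    simp [h0] at this
  · rw [he]
    exact lam_one_le h h0 hm

/-! ### Global existence for bounded Lipschitz vector fields -/

/-- On [0, N+1] a solution moves by at most C(N+1), so Picard–Lindelöf applies on a ball of that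
radius; uniqueness glues the solutions. -/
theorem exists_forall_hasDerivWithinAt_Ici {E : Type*} [NormedAddCommGroup E] [NormedSpace ℝ E]
    [CompleteSpace E] {f : E → E} {L C : NNReal} (hL : LipschitzWith L f) (hC : ∀ x, ‖f x‖ ≤ C)
    (x₀ : E) :
    ∃ φ : ℝ → E, φ 0 = x₀ ∧ ∀ t, 0 ≤ t → HasDerivWithinAt φ (f (φ t)) (Set.Ici 0) t := by
  have hloc : ∀ N : ℕ, ∃ α : ℝ → E, α 0 = x₀ ∧ ∀ t ∈ Set.Icc (0 : ℝ) (N + 1),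
      HasDerivWithinAt α (f (α t)) (Set.Icc (0 : ℝ) (N + 1)) t := by
    intro N
    have hN : (0 : ℝ) ≤ N + 1 := by positivity
    have hpl : IsPicardLindelof (fun _ => f) (tmin := 0) (tmax := (N : ℝ) + 1)
        ⟨0, Set.left_mem_Icc.2 hN⟩ x₀ (C * (N + 1)) 0 C L :=
      IsPicardLindelof.of_time_independent (fun x _ => hC x) hL.lipschitzOnWith (by
        simp [max_eq_left hN])
    exact hpl.exists_eq_forall_mem_Icc_hasDerivWithinAt₀
  choose α hα0 hα using hloc
  have hcont : ∀ N, ContinuousOn (α N) (Set.Icc (0 : ℝ) (N + 1)) := fun N t ht =>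
    (hα N t ht).continuousWithinAt
  have hright : ∀ N : ℕ, ∀ t ∈ Set.Ico (0 : ℝ) (N + 1),
      HasDerivWithinAt (α N) (f (α N t)) (Set.Ici t) t := by
    intro N t ht
    refine (hα N t ⟨ht.1, ht.2.le⟩).mono_of_mem_nhdsWithin ?_
    exact mem_of_superset (Icc_mem_nhdsGE ht.2) (Set.Icc_subset_Icc_left ht.1)
  have hagree : ∀ N M : ℕ, N ≤ M → Set.EqOn (α N) (α M) (Set.Icc (0 : ℝ) (N + 1)) := by
    intro N M hNM
    have hle : (N : ℝ) + 1 ≤ M + 1 := by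
      have : (N : ℝ) ≤ M := by exact_mod_cast hNM
      linarith
    refine ODE_solution_unique_of_mem_Icc_right (v := fun _ => f) (s := fun _ => Set.univ) (K := L)
      (fun t _ => hL.lipschitzOnWith) (hcont N) (hright N) (fun _ _ => Set.mem_univ _)
      ((hcont M).mono (Set.Icc_subset_Icc_right hle))
      (fun t ht => hright M t ⟨ht.1, ht.2.trans_le hle⟩) (fun _ _ => Set.mem_univ _) ?_
    rw [hα0, hα0]
  have hφ : ∀ N : ℕ, ∀ s ∈ Set.Icc (0 : ℝ) (N + 1), α ⌊s⌋₊ s = α N s := by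
    intro N s hs
    rcases le_total ⌊s⌋₊ N with h | h
    · exact hagree _ _ h ⟨hs.1, (Nat.lt_floor_add_one s).le⟩
    · exact (hagree _ _ h hs).symm
  -- Solution number ⌊t⌋ lives on [0, ⌊t⌋+1], which extends strictly beyond t and so contains a
  -- neighbourhood of t in `Ici 0`.
  refine ⟨fun t => α ⌊t⌋₊ t, by simp [hα0], fun t ht => ?_⟩
  have htm : t ∈ Set.Icc (0 : ℝ) (⌊t⌋₊ + 1) := ⟨ht, (Nat.lt_floor_add_one t).le⟩
  have h1 : HasDerivWithinAt (fun t => α ⌊t⌋₊ t) (f (α ⌊t⌋₊ t)) (Set.Icc (0 : ℝ) (⌊t⌋₊ + 1)) t :=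
    (hα ⌊t⌋₊ t htm).congr (fun s hs => hφ _ s hs) rfl
  refine h1.mono_of_mem_nhdsWithin ?_
  have : Set.Iio ((⌊t⌋₊ : ℝ) + 1) ∈ 𝓝 t := Iio_mem_nhds (Nat.lt_floor_add_one t)
  filter_upwards [mem_nhdsWithin_of_mem_nhds this, self_mem_nhdsWithin] with s hs1 hs2
  exact ⟨hs2, le_of_lt hs1⟩

/-- Stability quantifies over trajectories, so refuting it requires one to exist. -/
theorem exists_trajectory {n : ℕ} (K : ℝ) (A : Matrix (Fin n) (Fin n) ℝ) (θ₀ : Fin n → ℝ) :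
    ∃ φ, IsTrajectory K A φ ∧ φ 0 = θ₀ := by
  set T : ℝ := |K| * ∑ i, ∑ j, |A i j| with hT
  have hT0 : 0 ≤ T := by positivity
  have hrow : ∀ (i : Fin n) (g : Fin n → ℝ) (B : ℝ), (∀ j, |g j| ≤ B) → 0 ≤ B →
      |K * ∑ j, A i j * g j| ≤ T * B := by
    intro i g B hg hB
    have h1 : |∑ j, A i j * g j| ≤ (∑ j, |A i j|) * B := by
      rw [Finset.sum_mul]
      refine (Finset.abs_sum_le_sum_abs _ _).trans (Finset.sum_le_sum fun j _ => ?_)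
      rw [abs_mul]
      exact mul_le_mul_of_nonneg_left (hg j) (abs_nonneg _)
    have h2 : ∑ j, |A i j| ≤ ∑ i, ∑ j, |A i j| :=
      Finset.single_le_sum (f := fun i => ∑ j, |A i j|)
        (fun i _ => Finset.sum_nonneg fun j _ => abs_nonneg _) (Finset.mem_univ i)
    rw [abs_mul, hT, mul_assoc]
    exact mul_le_mul_of_nonneg_left (h1.trans (mul_le_mul_of_nonneg_right h2 hB)) (abs_nonneg _)
  have hL : LipschitzWith (T * 2).toNNReal (field K A) := by
    refine LipschitzWith.of_dist_le_mul fun θ η => ?_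
    rw [Real.coe_toNNReal _ (by positivity), dist_eq_norm, pi_norm_le_iff_of_nonneg (by positivity)]
    intro i
    have e : (field K A θ - field K A η) i =
        K * ∑ j, A i j * (sin (θ j - θ i) - sin (η j - η i)) := by
      simp only [field, Pi.sub_apply, mul_sub, Finset.sum_sub_distrib]
    rw [e, Real.norm_eq_abs, mul_assoc]
    refine hrow i _ _ (fun j => ?_) (by positivity)
    refine (Real.abs_sin_sub_sin_le _ _).trans ?_
    have h1 : |θ j - η j| ≤ dist θ η := by
      rw [← Real.dist_eq]; exact dist_le_pi_dist θ η j
    have h2 : |θ i - η i| ≤ dist θ η := by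
      rw [← Real.dist_eq]; exact dist_le_pi_dist θ η i
    have e : θ j - θ i - (η j - η i) = (θ j - η j) - (θ i - η i) := by ring
    rw [e]
    exact (abs_sub _ _).trans (by linarith)
  have hC : ∀ θ, ‖field K A θ‖ ≤ T.toNNReal := by
    intro θ
    rw [Real.coe_toNNReal _ hT0, pi_norm_le_iff_of_nonneg hT0]
    intro i
    have := hrow i (fun j => sin (θ j - θ i)) 1 (fun j => abs_sin_le_one _) zero_le_one
    rwa [mul_one] at this
  obtain ⟨φ, h0, hφ⟩ := exists_forall_hasDerivWithinAt_Ici hL hC θ₀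
  exact ⟨φ, hφ, h0⟩

/-! ### Symmetrization -/

theorem two_mul_sum_mul_antisymm {n : ℕ} (u : Fin n → ℝ) (g : Fin n → Fin n → ℝ)
    (hg : ∀ i j, g j i = - g i j) :
    2 * ∑ i, u i * ∑ j, g i j = - ∑ i, ∑ j, (u j - u i) * g i j := by
  have h1 : ∑ i, u i * ∑ j, g i j = ∑ i, ∑ j, u i * g i j := by simp_rw [Finset.mul_sum]
  have h2 : ∑ i, ∑ j, u j * g i j = - ∑ i, ∑ j, u i * g i j := by
    rw [Finset.sum_comm, ← Finset.sum_neg_distrib]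
    refine Finset.sum_congr rfl fun i _ => ?_
    rw [← Finset.sum_neg_distrib]
    exact Finset.sum_congr rfl fun j _ => by rw [hg i j]; ring
  simp_rw [sub_mul, Finset.sum_sub_distrib]
  rw [h2, h1]; ring

theorem two_mul_dotProduct_field {n k : ℕ} (K : ℝ) (u θ : Fin n → ℝ) :
    2 * (u ⬝ᵥ field K (adj n k) θ) =
      - (K * ∑ i, ∑ j, adj n k i j * ((u j - u i) * sin (θ j - θ i))) := by
  have h := two_mul_sum_mul_antisymm u (fun i j => adj n k i j * sin (θ j - θ i)) (by
    intro i j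
    rw [adj_symm n k j i, ← neg_sub (θ j) (θ i), Real.sin_neg]; ring)
  have e1 : u ⬝ᵥ field K (adj n k) θ = K * ∑ i, u i * ∑ j, adj n k i j * sin (θ j - θ i) := by
    simp only [dotProduct, field, Finset.mul_sum]
    exact Finset.sum_congr rfl fun i _ => Finset.sum_congr rfl fun j _ => by ring
  rw [e1, mul_left_comm, h, mul_neg]
  congr 2
  exact Finset.sum_congr rfl fun i _ => Finset.sum_congr rfl fun j _ => by ring

/-- Testing the field against the constant vector; hence the mean phase is conserved. -/
theorem sum_field_eq_zero {n k : ℕ} (K : ℝ) (θ : Fin n → ℝ) : ∑ i, field K (adj n k) θ i = 0 := by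
  have h := two_mul_dotProduct_field (k := k) K (fun _ => 1) θ
  simp only [sub_self, zero_mul, mul_zero, Finset.sum_const_zero, neg_zero] at h
  simpa [dotProduct] using h

/-! ### The twisted state: equilibrium and second variation -/

theorem isEquilibrium_twisted {n k : ℕ} (h : Admissible n k) (K : ℝ) :
    IsEquilibrium K (adj n k) (twisted n) := by
  have hn0 : n ≠ 0 := by have := h.2; omega
  funext i
  simp only [field, twisted, Pi.zero_apply]
  have h1 := sum_adj_mul h i (fun t : ℤ => sin ((1 : ℕ) * (2 * π * ((t - (i : ℕ) : ℤ) : ℝ) / n)))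
    (fun t => by
      rw [show t + (n : ℤ) - ((i : ℕ) : ℤ) = t - (i : ℕ) + n by ring]
      exact periodic_mode hn0 sin Real.sin_periodic 1 _)
  have h2 : ∀ j : Fin n, adj n k i j * sin (2 * π * (j : ℕ) / n - 2 * π * (i : ℕ) / n) =
      adj n k i j * sin ((1 : ℕ) * (2 * π * ((((j : ℕ) : ℤ) - (i : ℕ) : ℤ) : ℝ) / n)) := by
    intro j
    push_cast
    congr 2
    ring
  rw [Finset.sum_congr rfl fun j _ => h2 j, h1, Finset.sum_eq_zero, mul_zero]
  intro d _
  have e1 : (((i : ℕ) + (d : ℤ) - (i : ℕ) : ℤ) : ℝ) = d := by push_cast; ring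
  have e2 : (((i : ℕ) - (d : ℤ) - (i : ℕ) : ℤ) : ℝ) = -d := by push_cast; ring
  rw [e1, e2, show ((1 : ℕ) : ℝ) * (2 * π * -(d : ℝ) / n) = -(((1 : ℕ) : ℝ) * (2 * π * d / n)) by
    ring, Real.sin_neg, add_neg_cancel]

/-- The equilibrium condition tested against u: the first-order term in the later expansions
vanishes. -/
theorem sum_adj_mul_sin_twisted {n k : ℕ} (h : Admissible n k) (u : Fin n → ℝ) :
    ∑ i, ∑ j, adj n k i j * ((u j - u i) * sin (twisted n j - twisted n i)) = 0 := by
  have h1 := two_mul_dotProduct_field (k := k) 1 u (twisted n)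
  rw [isEquilibrium_twisted h 1, dotProduct_zero] at h1
  linarith

theorem two_mul_dotProduct_wlap_one (n k : ℕ) (u : Fin n → ℝ) :
    2 * (u ⬝ᵥ wlap n k 1 u) =
      ∑ i, ∑ j, adj n k i j * (cos (twisted n j - twisted n i) * (u j - u i) ^ 2) := by
  rw [dotProduct_wlap]
  refine Finset.sum_congr rfl fun i _ => Finset.sum_congr rfl fun j _ => ?_
  simp only [twisted, Nat.cast_one, one_mul]
  ring

/-! ### Taylor bounds -/

theorem abs_sin_sub_self_le (w : ℝ) : |sin w - w| ≤ |w| ^ 3 / 6 := by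
  have key : ∀ w : ℝ, 0 ≤ w → |sin w - w| ≤ w ^ 3 / 6 := by
    intro w hw
    rcases hw.eq_or_lt with rfl | hw
    · simp
    · have h1 := Real.sin_gt_sub_cube hw
      have h2 := Real.sin_lt hw
      rw [abs_le]; constructor <;> linarith [pow_pos hw 3]
  rcases le_total 0 w with h | h
  · rw [abs_of_nonneg h]; exact key w h
  · have := key (-w) (by linarith)
    rw [Real.sin_neg, ← neg_sub', abs_neg] at this
    rwa [abs_of_nonpos h]

/-- Expands sin(Δ + w); the errors of cos w ≈ 1 and sin w ≈ w are each at most w²/2. -/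
theorem cos_mul_sq_sub_le (Δ w : ℝ) (hw : |w| ≤ 1) :
    cos Δ * w ^ 2 - |w| * w ^ 2 ≤ w * (sin (Δ + w) - sin Δ) := by
  have h1 := abs_sin_sub_self_le w
  have h2 := Real.one_sub_sq_div_two_le_cos (x := w)
  have h3 := cos_le_one w
  have h4 : |sin Δ * (cos w - 1) + cos Δ * (sin w - w)| ≤ w ^ 2 := by
    refine (abs_add_le _ _).trans ?_
    rw [abs_mul, abs_mul]
    have a1 : |sin Δ| * |cos w - 1| ≤ 1 * (w ^ 2 / 2) := by
      refine mul_le_mul (abs_sin_le_one _) ?_ (abs_nonneg _) zero_le_one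
      rw [abs_le]; constructor <;> nlinarith [sq_nonneg w]
    have a2 : |cos Δ| * |sin w - w| ≤ 1 * (w ^ 2 / 2) := by
      refine mul_le_mul (abs_cos_le_one _) (h1.trans ?_) (abs_nonneg _) zero_le_one
      have : |w| ^ 3 ≤ |w| ^ 2 := pow_le_pow_of_le_one (abs_nonneg _) hw (by norm_num)
      rw [sq_abs] at this
      nlinarith [sq_nonneg w]
    linarith
  have h5 : |w * (sin Δ * (cos w - 1) + cos Δ * (sin w - w))| ≤ |w| * w ^ 2 := by
    rw [abs_mul]; exact mul_le_mul_of_nonneg_left h4 (abs_nonneg _)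
  have h6 := neg_le_of_abs_le h5
  rw [sin_add]
  nlinarith

theorem cos_add_lower_bound (Δ w : ℝ) (hw : |w| ≤ 1) :
    cos Δ - w * sin Δ - cos Δ * w ^ 2 / 2 - |w| ^ 3 ≤ cos (Δ + w) := by
  have h1 := abs_sin_sub_self_le w
  have h2 := Real.cos_bound hw
  have h4 : |cos Δ * (cos w - (1 - w ^ 2 / 2)) - sin Δ * (sin w - w)| ≤ |w| ^ 3 := by
    refine (abs_sub _ _).trans ?_
    rw [abs_mul, abs_mul]
    have h0 : 0 ≤ |w| ^ 3 := by positivity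
    have a1 : |cos Δ| * |cos w - (1 - w ^ 2 / 2)| ≤ 1 * (|w| ^ 3 / 2) := by
      refine mul_le_mul (abs_cos_le_one _) (h2.trans ?_) (abs_nonneg _) zero_le_one
      have : |w| ^ 4 ≤ |w| ^ 3 := pow_le_pow_of_le_one (abs_nonneg _) hw (by norm_num)
      linarith
    have a2 : |sin Δ| * |sin w - w| ≤ 1 * (|w| ^ 3 / 2) := by
      refine mul_le_mul (abs_sin_le_one _) (h1.trans ?_) (abs_nonneg _) zero_le_one
      linarith
    linarith
  have h6 := neg_le_of_abs_le h4
  rw [cos_add]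
  nlinarith

/-! ### Nonlinear stability -/

theorem sum_adj_mul_sq_le (n k : ℕ) (u : Fin n → ℝ) :
    ∑ i, ∑ j, adj n k i j * (u j - u i) ^ 2 ≤ 4 * n * (u ⬝ᵥ u) := by
  have h1 : ∑ i, ∑ j, adj n k i j * (u j - u i) ^ 2 ≤
      ∑ i : Fin n, ∑ j : Fin n, (2 * (u j * u j) + 2 * (u i * u i)) := by
    refine Finset.sum_le_sum fun i _ => Finset.sum_le_sum fun j _ => ?_
    have := mul_le_mul_of_nonneg_right (adj_le_one n k i j) (sq_nonneg (u j - u i))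
    nlinarith [sq_nonneg (u j + u i)]
  refine h1.trans (le_of_eq ?_)
  simp only [Finset.sum_add_distrib, ← Finset.mul_sum, Finset.sum_const, Finset.card_univ,
    Fintype.card_fin, nsmul_eq_mul, dotProduct]
  simp only [mul_left_comm _ (n : ℝ), ← Finset.mul_sum]
  ring

/-- The Lyapunov inequality for |u|². The quadratic form is at least 2γ|u|², and the cubic error is
at most 2η·4n|u|² ≤ γ|u|², which leaves γ|u|². -/
theorem dotProduct_field_le {n k : ℕ} (h : Admissible n k) {K γ η : ℝ} (hK : 0 < K)
    (hγ : ∀ m : ℕ, 1 ≤ m → m < n → γ ≤ weig n k 1 m) (hη2 : η ≤ 1 / 2)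
    (hη : 8 * n * η ≤ γ) {u : Fin n → ℝ} (hu : ∑ i, u i = 0) (hb : ∀ i, |u i| ≤ η) :
    2 * (u ⬝ᵥ field K (adj n k) (twisted n + u)) ≤ - (K * γ) * (u ⬝ᵥ u) := by
  have h1 := two_mul_dotProduct_field (k := k) K u (twisted n + u)
  have h2 := sum_adj_mul_sin_twisted h u
  have h3 := two_mul_dotProduct_wlap_one n k u
  have h4 := le_dotProduct_wlap h 1 γ (by simpa using hγ) u hu
  have h5 := sum_adj_mul_sq_le n k u
  have hη0 : 0 ≤ η := by
    have : 0 < n := by have := h.2; omega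
    exact (abs_nonneg _).trans (hb ⟨0, this⟩)
  have hlow : ∑ i, ∑ j, adj n k i j * (cos (twisted n j - twisted n i) * (u j - u i) ^ 2) -
      2 * η * ∑ i, ∑ j, adj n k i j * (u j - u i) ^ 2 ≤
      ∑ i, ∑ j, adj n k i j * ((u j - u i) * sin ((twisted n + u) j - (twisted n + u) i)) -
      ∑ i, ∑ j, adj n k i j * ((u j - u i) * sin (twisted n j - twisted n i)) := by
    simp only [Finset.mul_sum, ← Finset.sum_sub_distrib]
    refine Finset.sum_le_sum fun i _ => Finset.sum_le_sum fun j _ => ?_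
    have hw : |u j - u i| ≤ 2 * η := (abs_sub _ _).trans (by linarith [hb i, hb j])
    have a1 := cos_mul_sq_sub_le (twisted n j - twisted n i) (u j - u i) (by linarith)
    have a2 : |u j - u i| * (u j - u i) ^ 2 ≤ 2 * η * (u j - u i) ^ 2 :=
      mul_le_mul_of_nonneg_right hw (sq_nonneg _)
    have e : (twisted n + u) j - (twisted n + u) i = twisted n j - twisted n i + (u j - u i) := by
      simp only [Pi.add_apply]; ring
    rw [e]
    have := mul_le_mul_of_nonneg_left (a1.trans' (sub_le_sub_left a2 _)) (adj_nonneg n k i j)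
    linarith
  have hS : 0 ≤ u ⬝ᵥ u := by
    simp only [dotProduct]
    exact Finset.sum_nonneg fun i _ => mul_self_nonneg _
  rw [h1, neg_mul, neg_le_neg_iff, mul_assoc]
  refine mul_le_mul_of_nonneg_left ?_ hK.le
  have h6 := mul_le_mul_of_nonneg_left h5 (by linarith : 0 ≤ 2 * η)
  have h7 := mul_le_mul_of_nonneg_right hη hS
  linarith

theorem field_add_const {n : ℕ} (K : ℝ) (A : Matrix (Fin n) (Fin n) ℝ) (θ : Fin n → ℝ) (c : ℝ) :
    field K A (fun i => θ i + c) = field K A θ := by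
  funext i
  simp [field]

theorem IsTrajectory.hasDerivWithinAt_apply {n : ℕ} {K : ℝ} {A : Matrix (Fin n) (Fin n) ℝ}
    {φ : ℝ → Fin n → ℝ} (hφ : IsTrajectory K A φ) {t : ℝ} (ht : 0 ≤ t) (i : Fin n) :
    HasDerivWithinAt (fun s => φ s i) (field K A (φ t) i) (Set.Ici 0) t :=
  (hasDerivWithinAt_pi.1 (hφ t ht)) i

theorem IsTrajectory.sum_eq {n k : ℕ} {K : ℝ} {φ : ℝ → Fin n → ℝ}
    (hφ : IsTrajectory K (adj n k) φ) {t : ℝ} (ht : 0 ≤ t) : ∑ i, φ t i = ∑ i, φ 0 i := by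
  have hd : ∀ s, 0 ≤ s → HasDerivWithinAt (fun s => ∑ i, φ s i) 0 (Set.Ici 0) s := by
    intro s hs
    have := HasDerivWithinAt.fun_sum (u := Finset.univ) fun i (_ : i ∈ Finset.univ) =>
      hφ.hasDerivWithinAt_apply hs i
    rwa [sum_field_eq_zero] at this
  refine constant_of_has_deriv_right_zero (f := fun s => ∑ i, φ s i) (a := 0) (b := t) ?_ ?_ t
    ⟨ht, le_rfl⟩
  · exact fun s hs => ((hd s hs.1).continuousWithinAt).mono Set.Icc_subset_Ici_self
  · exact fun s hs => (hd s hs.1).mono (Set.Ici_subset_Ici.2 hs.1)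

/-- Exponential decay towards the twisted state, up to a common shift of the phases. -/
theorem exists_decay {n k : ℕ} (h : Admissible n k)
    (hw : ∀ m : ℕ, 1 ≤ m → m < n → 0 < weig n k 1 m) {K : ℝ} (hK : 0 < K) :
    ∃ η a : ℝ, 0 < η ∧ 0 < a ∧ ∀ ρ : ℝ, 0 < ρ → ρ ≤ η → ∀ φ : ℝ → Fin n → ℝ,
      IsTrajectory K (adj n k) φ → ‖φ 0 - twisted n‖ < ρ / (2 * n) →
      ∃ c : ℝ, |c| ≤ ρ ∧ ∀ t : ℝ, 0 ≤ t → ∀ i,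
        |φ t i - twisted n i - c| ≤ ρ * exp (-a * t) := by
  have hn : 3 ≤ n := by have := h.1; have := h.2; omega
  have hn' : (3 : ℝ) ≤ n := by exact_mod_cast hn
  obtain ⟨m₀, hm₀, hmin⟩ := Finset.exists_min_image (Finset.Ico 1 n) (fun m : ℕ => weig n k 1 m)
    ⟨1, by simp; omega⟩
  rw [Finset.mem_Ico] at hm₀
  set γ := weig n k 1 m₀ with hγdef
  have hγ0 : 0 < γ := hw m₀ hm₀.1 hm₀.2
  have hγ : ∀ m : ℕ, 1 ≤ m → m < n → γ ≤ weig n k 1 m := fun m h1 h2 =>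
    hmin m (Finset.mem_Ico.2 ⟨h1, h2⟩)
  set η := min (1 / 2) (γ / (8 * n)) with hηdef
  have hη0 : 0 < η := by positivity
  have hη2 : η ≤ 1 / 2 := min_le_left _ _
  have hη8 : 8 * n * η ≤ γ := by
    have : η ≤ γ / (8 * n) := min_le_right _ _
    rw [le_div_iff₀ (by positivity)] at this
    linarith
  refine ⟨η, K * γ / 4, hη0, by positivity, fun ρ hρ0 hρη φ hφ hini => ?_⟩
  -- c is the mean deviation, conserved by the flow, so subtracting it keeps u at mean zero for all
  -- time.
  set c : ℝ := (∑ i, (φ 0 i - twisted n i)) / n with hc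
  have hini' : ∀ i, |φ 0 i - twisted n i| ≤ ρ / (2 * n) := fun i =>
    (norm_le_pi_norm (φ 0 - twisted n) i).trans hini.le
  have hρn : ρ / (2 * n) ≤ ρ := div_le_self hρ0.le (by linarith)
  have hc1 : |c| ≤ ρ / (2 * n) := by
    rw [hc, abs_div, abs_of_nonneg (by linarith : (0 : ℝ) ≤ n), div_le_iff₀ (by linarith)]
    refine (Finset.abs_sum_le_sum_abs _ _).trans ((Finset.sum_le_sum fun i _ => hini' i).trans ?_)
    simp [mul_comm]
  refine ⟨c, hc1.trans hρn, ?_⟩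
  let u : ℝ → Fin n → ℝ := fun t i => φ t i - twisted n i - c
  have husum : ∀ t, 0 ≤ t → ∑ i, u t i = 0 := by
    intro t ht
    simp only [u, Finset.sum_sub_distrib, hφ.sum_eq ht, Finset.sum_const, Finset.card_univ,
      Fintype.card_fin, nsmul_eq_mul, hc]
    field_simp
    ring
  have hfield : ∀ t, field K (adj n k) (φ t) = field K (adj n k) (twisted n + u t) := by
    intro t
    rw [← field_add_const K _ (twisted n + u t) c]
    congr 1
    funext i
    simp only [u, Pi.add_apply]
    ring
  have hud : ∀ t, 0 ≤ t → ∀ i, HasDerivWithinAt (fun s => u s i) (field K (adj n k) (φ t) i)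
      (Set.Ici 0) t := fun t ht i =>
    ((hφ.hasDerivWithinAt_apply ht i).sub_const _).sub_const _
  have hSd : ∀ t, 0 ≤ t → HasDerivWithinAt (fun s => u s ⬝ᵥ u s)
      (2 * (u t ⬝ᵥ field K (adj n k) (twisted n + u t))) (Set.Ici 0) t := by
    intro t ht
    have := HasDerivWithinAt.fun_sum (u := Finset.univ) fun i (_ : i ∈ Finset.univ) =>
      (hud t ht i).mul (hud t ht i)
    refine this.congr_deriv ?_
    rw [← hfield, dotProduct, Finset.mul_sum]
    exact Finset.sum_congr rfl fun i _ => by ring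
  have hle : ∀ t i, u t i ^ 2 ≤ u t ⬝ᵥ u t := by
    intro t i
    rw [sq]
    exact Finset.single_le_sum (f := fun i => u t i * u t i) (fun i _ => mul_self_nonneg _)
      (Finset.mem_univ i)
  -- Barrier argument: whenever |u|² touches the barrier, |u| ≤ ρ ≤ η and the Lyapunov inequality
  -- gives rate Kγ, strictly faster than the barrier's Kγ/2. The square root later halves the rate
  -- to Kγ/4.
  have hdecay : ∀ t, 0 ≤ t → u t ⬝ᵥ u t ≤ ρ ^ 2 * exp (-(K * γ / 2) * t) := by
    intro t ht
    refine image_le_of_deriv_right_lt_deriv_boundary (f := fun s => u s ⬝ᵥ u s)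
      (f' := fun s => 2 * (u s ⬝ᵥ field K (adj n k) (twisted n + u s))) (a := 0) (b := t)
      (B := fun s => ρ ^ 2 * exp (-(K * γ / 2) * s))
      (B' := fun s => ρ ^ 2 * (exp (-(K * γ / 2) * s) * (-(K * γ / 2))))
      (fun s hs => ((hSd s hs.1).continuousWithinAt).mono Set.Icc_subset_Ici_self)
      (fun s hs => (hSd s hs.1).mono (Set.Ici_subset_Ici.2 hs.1)) ?_ ?_ ?_ ⟨ht, le_rfl⟩
    · simp only [mul_zero, exp_zero, mul_one]
      -- The initial radius ρ/(2n) is chosen so that deviation plus mean is at most ρ/n, whence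
      -- |u(0)|² ≤ ρ²/n ≤ ρ².
      have hu0 : ∀ i, u 0 i * u 0 i ≤ (ρ / n) ^ 2 := by
        intro i
        rw [← sq]
        refine sq_le_sq' ?_ ?_
        · have := neg_le_of_abs_le ((abs_sub (φ 0 i - twisted n i) c).trans
            (add_le_add (hini' i) hc1))
          have e : ρ / (2 * n) + ρ / (2 * n) = ρ / n := by field_simp; ring
          rwa [e] at this
        · have := le_of_abs_le ((abs_sub (φ 0 i - twisted n i) c).trans
            (add_le_add (hini' i) hc1))
          have e : ρ / (2 * n) + ρ / (2 * n) = ρ / n := by field_simp; ring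
          rwa [e] at this
      refine (Finset.sum_le_sum fun i _ => hu0 i).trans ?_
      rw [Finset.sum_const, Finset.card_univ, Fintype.card_fin, nsmul_eq_mul, div_pow,
        mul_div_assoc', div_le_iff₀ (by positivity)]
      have hnn : (n : ℝ) ≤ n ^ 2 := by nlinarith
      rw [mul_comm]
      exact mul_le_mul_of_nonneg_left hnn (sq_nonneg ρ)
    · intro s
      have h1 : HasDerivAt (fun s : ℝ => -(K * γ / 2) * s) (-(K * γ / 2)) s := by
        simpa using (hasDerivAt_id s).const_mul (-(K * γ / 2))
      exact (h1.exp).const_mul _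
    · intro s hs heq
      have hexp : exp (-(K * γ / 2) * s) ≤ 1 := by
        rw [exp_le_one_iff]
        have : 0 ≤ K * γ / 2 * s := mul_nonneg (by positivity) hs.1
        linarith
      have hpos : 0 < ρ ^ 2 * exp (-(K * γ / 2) * s) := by positivity
      have hb : ∀ i, |u s i| ≤ η := by
        intro i
        refine abs_le_of_sq_le_sq ?_ hη0.le
        have h1 := hle s i
        have h2 : ρ ^ 2 ≤ η ^ 2 := pow_le_pow_left₀ hρ0.le hρη 2
        nlinarith [sq_nonneg ρ]
      have hmain := dotProduct_field_le h hK hγ hη2 hη8 (husum s hs.1) hb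
      rw [heq] at hmain
      refine hmain.trans_lt ?_
      have : 0 < K * γ * (ρ ^ 2 * exp (-(K * γ / 2) * s)) := by positivity
      linarith
  intro t ht i
  refine abs_le_of_sq_le_sq ?_ (by positivity)
  refine (hle t i).trans ((hdecay t ht).trans (le_of_eq ?_))
  rw [mul_pow, ← Real.exp_nat_mul]
  congr 2
  push_cast; ring

theorem isStableEquilibrium_of_weig_pos {n k : ℕ} (h : Admissible n k)
    (hw : ∀ m : ℕ, 1 ≤ m → m < n → 0 < weig n k 1 m) {K : ℝ} (hK : 0 < K) :
    IsStableEquilibrium K (adj n k) (twisted n) := by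
  have hn : 0 < n := by have := h.2; omega
  have hn' : (0 : ℝ) < n := by exact_mod_cast hn
  obtain ⟨η, a, hη, ha, hdec⟩ := exists_decay h hw hK
  refine ⟨isEquilibrium_twisted h K, fun ε hε => ?_, η / (2 * n), by positivity,
    fun φ hφ hini => ?_⟩
  · have hρ : 0 < min η (ε / 4) := by positivity
    refine ⟨min η (ε / 4) / (2 * n), by positivity, fun φ hφ hini t ht => ?_⟩
    obtain ⟨c, hc, hdc⟩ := hdec _ hρ (min_le_left _ _) φ hφ hini
    rw [pi_norm_lt_iff hε]
    intro i
    have h1 := hdc t ht i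
    have h2 : exp (-a * t) ≤ 1 := by
      rw [exp_le_one_iff]; nlinarith
    have h3 : min η (ε / 4) * exp (-a * t) ≤ min η (ε / 4) := mul_le_of_le_one_right hρ.le h2
    have h4 : min η (ε / 4) ≤ ε / 4 := min_le_right _ _
    have e : (φ t - twisted n) i = (φ t i - twisted n i - c) + c := by simp
    rw [e, Real.norm_eq_abs]
    refine (abs_add_le _ _).trans_lt ?_
    linarith
  · obtain ⟨c, -, hdc⟩ := hdec η hη le_rfl φ hφ hini
    refine ⟨c, tendsto_pi_nhds.2 fun i => ?_⟩
    rw [tendsto_iff_norm_sub_tendsto_zero]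
    have h0 : Tendsto (fun t : ℝ => η * exp (-a * t)) atTop (𝓝 0) := by
      have h1 : Tendsto (fun t : ℝ => -a * t) atTop atBot :=
        tendsto_id.const_mul_atTop_of_neg (by linarith)
      simpa using (Real.tendsto_exp_atBot.comp h1).const_mul η
    refine squeeze_zero' (Eventually.of_forall fun t => norm_nonneg _) ?_ h0
    filter_upwards [eventually_ge_atTop 0] with t ht
    have := hdc t ht i
    rwa [Real.norm_eq_abs, ← sub_sub]

/-! ### Instability -/

/-- The potential of the Kuramoto system. -/
noncomputable def energy (n k : ℕ) (θ : Fin n → ℝ) : ℝ :=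
  - ∑ i, ∑ j, adj n k i j * cos (θ j - θ i)

theorem continuous_energy (n k : ℕ) : Continuous (energy n k) := by
  unfold energy
  fun_prop

theorem energy_add_const (n k : ℕ) (θ : Fin n → ℝ) (c : ℝ) :
    energy n k (fun i => θ i + c) = energy n k θ := by
  simp [energy]

/-- The system is a gradient flow: the energy has derivative -(2/K)|field|². -/
theorem IsTrajectory.energy_le {n k : ℕ} {K : ℝ} (hK : 0 < K) {φ : ℝ → Fin n → ℝ}
    (hφ : IsTrajectory K (adj n k) φ) {t : ℝ} (ht : 0 ≤ t) :
    energy n k (φ t) ≤ energy n k (φ 0) := by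
  have hd : ∀ s, 0 ≤ s → HasDerivWithinAt (fun s => energy n k (φ s))
      (-(2 / K * (field K (adj n k) (φ s) ⬝ᵥ field K (adj n k) (φ s)))) (Set.Ici 0) s := by
    intro s hs
    have h1 : HasDerivWithinAt (fun s => ∑ i, ∑ j, adj n k i j * cos (φ s j - φ s i))
        (∑ i, ∑ j, adj n k i j * (-sin (φ s j - φ s i) *
          (field K (adj n k) (φ s) j - field K (adj n k) (φ s) i))) (Set.Ici 0) s :=
      HasDerivWithinAt.fun_sum fun i _ => HasDerivWithinAt.fun_sum fun j _ =>
        (((hφ.hasDerivWithinAt_apply hs j).sub (hφ.hasDerivWithinAt_apply hs i)).cos).const_mul _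
    refine h1.neg.congr_deriv ?_
    have h2 := two_mul_dotProduct_field (k := k) K (field K (adj n k) (φ s)) (φ s)
    have e : 2 / K * (field K (adj n k) (φ s) ⬝ᵥ field K (adj n k) (φ s)) =
        (2 * (field K (adj n k) (φ s) ⬝ᵥ field K (adj n k) (φ s))) / K := by ring
    rw [e, h2, neg_div, mul_div_cancel_left₀ _ hK.ne', neg_neg, ← Finset.sum_neg_distrib]
    refine Finset.sum_congr rfl fun i _ => ?_
    rw [← Finset.sum_neg_distrib]
    exact Finset.sum_congr rfl fun j _ => by ring
  have hanti : AntitoneOn (fun s => energy n k (φ s)) (Set.Ici 0) := by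
    refine antitoneOn_of_hasDerivWithinAt_nonpos (convex_Ici 0)
      (fun s hs => (hd s hs).continuousWithinAt)
      (fun s hs => (hd s (interior_subset hs)).mono interior_subset) (fun s hs => ?_)
    rw [neg_nonpos]
    exact mul_nonneg (by positivity) (Finset.sum_nonneg fun i _ => mul_self_nonneg _)
  exact hanti Set.self_mem_Ici ht ht

theorem exists_energy_lt {n k : ℕ} (h : Admissible n k) (hw : weig n k 1 1 < 0) {δ : ℝ}
    (hδ : 0 < δ) : ∃ θ, ‖θ - twisted n‖ < δ ∧ energy n k θ < energy n k (twisted n) := by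
  have hn : 0 < n := by have := h.2; omega
  set v := cosMode n 1 with hv
  have hvb : ∀ i, |v i| ≤ 1 := fun i => abs_cos_le_one _
  set Q := ∑ i, ∑ j, adj n k i j * (cos (twisted n j - twisted n i) * (v j - v i) ^ 2) with hQ
  have hQneg : Q < 0 := by
    rw [hQ, ← two_mul_dotProduct_wlap_one, cosMode_dotProduct_wlap h]
    have hvv : 0 < cosMode n 1 ⬝ᵥ cosMode n 1 := by
      refine lt_of_le_of_ne (Finset.sum_nonneg fun i _ => mul_self_nonneg _) (Ne.symm fun h0 => ?_)
      exact cosMode_ne_zero hn 1 (dotProduct_self_eq_zero.1 h0)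
    push_cast
    nlinarith
  set C := ∑ i, ∑ j, adj n k i j * |v j - v i| ^ 3 with hC
  have hC0 : 0 ≤ C := Finset.sum_nonneg fun i _ => Finset.sum_nonneg fun j _ =>
    mul_nonneg (adj_nonneg n k i j) (by positivity)
  -- Along s·v the energy changes by at most s²Q/2 + s³C; the last bound on s makes the negative
  -- quadratic term dominate.
  obtain ⟨s, hs0, hs⟩ : ∃ s : ℝ, 0 < s ∧ s < min (min (1 / 2) δ) (-Q / (2 * (C + 1))) :=
    exists_between (lt_min (lt_min (by norm_num) hδ) (div_pos (by linarith) (by linarith)))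
  have hs1 : s < 1 / 2 := hs.trans_le ((min_le_left _ _).trans (min_le_left _ _))
  have hs2 : s < δ := hs.trans_le ((min_le_left _ _).trans (min_le_right _ _))
  have hs3 : s * (2 * (C + 1)) < -Q := by
    rw [← lt_div_iff₀ (by linarith)]
    exact hs.trans_le (min_le_right _ _)
  refine ⟨twisted n + s • v, ?_, ?_⟩
  · rw [add_sub_cancel_left, pi_norm_lt_iff hδ]
    intro i
    rw [Pi.smul_apply, smul_eq_mul, Real.norm_eq_abs, abs_mul, abs_of_pos hs0]
    nlinarith [hvb i]
  · have h1 := sum_adj_mul_sin_twisted h v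
    have hlow : energy n k (twisted n + s • v) ≤ energy n k (twisted n) +
        s * (∑ i, ∑ j, adj n k i j * ((v j - v i) * sin (twisted n j - twisted n i))) +
        s ^ 2 / 2 * Q + s ^ 3 * C := by
      have h2 : energy n k (twisted n) = ∑ i, ∑ j, - (adj n k i j *
          cos (twisted n j - twisted n i)) := by
        simp [energy, Finset.sum_neg_distrib]
      have h3 : energy n k (twisted n + s • v) = ∑ i, ∑ j, - (adj n k i j *
          cos ((twisted n + s • v) j - (twisted n + s • v) i)) := by
        simp only [energy, Finset.sum_neg_distrib]
      rw [h2, h3, hQ, hC]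
      simp only [Finset.mul_sum, ← Finset.sum_add_distrib]
      refine Finset.sum_le_sum fun i _ => Finset.sum_le_sum fun j _ => ?_
      have e : (twisted n + s • v) j - (twisted n + s • v) i =
          twisted n j - twisted n i + s * (v j - v i) := by
        simp only [Pi.add_apply, Pi.smul_apply, smul_eq_mul]; ring
      have hb : |s * (v j - v i)| ≤ 1 := by
        rw [abs_mul, abs_of_pos hs0]
        have : |v j - v i| ≤ 2 := (abs_sub _ _).trans (by linarith [hvb i, hvb j])
        nlinarith
      have a1 := cos_add_lower_bound (twisted n j - twisted n i) (s * (v j - v i)) hb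
      rw [abs_mul, abs_of_pos hs0, mul_pow, mul_pow] at a1
      rw [e]
      have := mul_le_mul_of_nonneg_left a1 (adj_nonneg n k i j)
      linarith
    rw [h1, mul_zero, add_zero] at hlow
    have : s ^ 2 / 2 * Q + s ^ 3 * C < 0 := by
      have e : s ^ 2 / 2 * Q + s ^ 3 * C = s ^ 2 / 2 * (Q + s * (2 * C)) := by ring
      rw [e]
      refine mul_neg_of_pos_of_neg (by positivity) ?_
      nlinarith
    linarith

/-- A trajectory started nearby at lower energy cannot converge to a shift of the twisted state,
since energy is continuous, shift-invariant and nonincreasing along the flow. -/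
theorem not_isStableEquilibrium_of_weig_neg {n k : ℕ} (h : Admissible n k)
    (hw : weig n k 1 1 < 0) {K : ℝ} (hK : 0 < K) :
    ¬ IsStableEquilibrium K (adj n k) (twisted n) := by
  rintro ⟨-, -, δ, hδ, hconv⟩
  obtain ⟨θ, hθ, hE⟩ := exists_energy_lt h hw hδ
  obtain ⟨φ, hφ, h0⟩ := exists_trajectory K (adj n k) θ
  obtain ⟨c, hc⟩ := hconv φ hφ (by rwa [h0])
  have hlim := ((continuous_energy n k).tendsto _).comp hc
  rw [energy_add_const] at hlim
  have hle : energy n k (twisted n) ≤ energy n k θ := by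
    refine le_of_tendsto hlim ?_
    filter_upwards [eventually_ge_atTop 0] with t ht
    rw [← h0]
    exact hφ.energy_le hK ht
  linarith

/-! ### The limiting condition number -/

theorem kappa_denominator_pos {μ : ℝ} (hμ : 0 < μ) : 0 < μ - sin (π * μ) / π := by
  rw [sub_pos, div_lt_iff₀ Real.pi_pos, mul_comm μ]
  exact Real.sin_lt (by positivity)

theorem analyticAt_kappa {μ : ℝ} (hμ : 0 < μ) : AnalyticAt ℝ kappa μ := by
  have h1 : AnalyticAt ℝ (fun μ : ℝ => μ - sin (2 * π * μ) / (2 * π)) μ := by fun_prop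
  have h2 : AnalyticAt ℝ (fun μ : ℝ => μ - sin (π * μ) / π) μ := by fun_prop
  exact h1.div h2 (kappa_denominator_pos hμ).ne'

/-- The sign of κ' at y = πμ. The difference of the sides is (1 - cos y)(sin y (2 + cos y) - y(1 + 2
cos y)). Beyond 2π/3 the factor 1 + 2 cos y is nonpositive; before it, cos y ≤ -0.2 gives the
numerical bound 1.26 < 1.2975. -/
theorem kappa_trig_inequality {y : ℝ} (h1 : 0.6 * π ≤ y) (h2 : y < π) :
    (1 - cos (2 * y)) * (y - sin y) < (y - sin (2 * y) / 2) * (1 - cos y) := by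
  have hpi := Real.pi_lt_d2
  have hpi' := Real.pi_gt_d2
  have hs : 0 < sin y := sin_pos_of_pos_of_lt_pi (by linarith) h2
  have hcc : cos y ≤ -0.2 := by
    have e : cos y = - sin (y - π / 2) := by rw [Real.sin_sub_pi_div_two, neg_neg]
    have a1 : sin (0.1 * π) ≤ sin (y - π / 2) :=
      Real.sin_le_sin_of_le_of_le_pi_div_two (by linarith) (by linarith) (by linarith)
    have a2 := Real.mul_le_sin (x := 0.1 * π) (by linarith) (by linarith)
    have a3 : 2 / π * (0.1 * π) = 0.2 := by field_simp; norm_num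
    linarith
  have key : y * (1 + 2 * cos y) < sin y * (2 + cos y) := by
    have hc1 := Real.neg_one_le_cos y
    rcases le_or_gt y (2 * π / 3) with h | h
    · have a1 : -(1 / 2) ≤ cos y := by
        have := cos_le_cos_of_nonneg_of_le_pi (by linarith : 0 ≤ y) (by linarith) h
        rwa [show 2 * π / 3 = π - π / 3 by ring, Real.cos_pi_sub, Real.cos_pi_div_three] at this
      have a2 : √3 / 2 ≤ sin y := by
        rw [← Real.sin_pi_div_three, ← Real.sin_pi_sub y]
        exact Real.sin_le_sin_of_le_of_le_pi_div_two (by linarith) (by linarith) (by linarith)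
      have a3 : 1.73 ≤ √3 := Real.le_sqrt_of_sq_le (by norm_num)
      have a4 : y * (1 + 2 * cos y) ≤ 2.1 * 0.6 :=
        mul_le_mul (by linarith) (by linarith) (by linarith) (by norm_num)
      have a5 : 0.865 * 1.5 ≤ sin y * (2 + cos y) :=
        mul_le_mul (by linarith) (by linarith) (by norm_num) hs.le
      linarith
    · have a1 : cos y ≤ -(1 / 2) := by
        have := cos_le_cos_of_nonneg_of_le_pi (by linarith : 0 ≤ 2 * π / 3) h2.le h.le
        rwa [show 2 * π / 3 = π - π / 3 by ring, Real.cos_pi_sub, Real.cos_pi_div_three] at this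
      have a2 : y * (1 + 2 * cos y) ≤ 0 :=
        mul_nonpos_of_nonneg_of_nonpos (by linarith) (by linarith)
      have a3 : 0 < sin y * (2 + cos y) := mul_pos hs (by linarith)
      linarith
  rw [cos_two_mul, sin_two_mul]
  have e : (y - 2 * sin y * cos y / 2) * (1 - cos y) -
      (1 - (2 * cos y ^ 2 - 1)) * (y - sin y) =
      (1 - cos y) * (sin y * (2 + cos y) - y * (1 + 2 * cos y)) := by ring
  have : 0 < (1 - cos y) * (sin y * (2 + cos y) - y * (1 + 2 * cos y)) :=
    mul_pos (by linarith) (by linarith)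
  linarith

theorem strictAntiOn_kappa : StrictAntiOn kappa (Set.Icc 0.6 1) := by
  refine strictAntiOn_of_deriv_neg (convex_Icc _ _)
    (fun μ hμ => (analyticAt_kappa (by linarith [hμ.1])).continuousAt.continuousWithinAt) ?_
  intro μ hμ
  rw [interior_Icc] at hμ
  have hμ0 : 0 < μ := by linarith [hμ.1]
  have hD := kappa_denominator_pos hμ0
  have hpi := Real.pi_pos
  have h1 : HasDerivAt (fun μ : ℝ => μ - sin (2 * π * μ) / (2 * π)) (1 - cos (2 * π * μ)) μ := by
    have a : HasDerivAt (fun μ : ℝ => 2 * π * μ) (2 * π) μ := by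
      simpa using (hasDerivAt_id μ).const_mul (2 * π)
    refine ((hasDerivAt_id μ).sub (a.sin.div_const (2 * π))).congr_deriv ?_
    field_simp
  have h2 : HasDerivAt (fun μ : ℝ => μ - sin (π * μ) / π) (1 - cos (π * μ)) μ := by
    have a : HasDerivAt (fun μ : ℝ => π * μ) π μ := by
      simpa using (hasDerivAt_id μ).const_mul π
    refine ((hasDerivAt_id μ).sub (a.sin.div_const π)).congr_deriv ?_
    field_simp
  have h3 : HasDerivAt kappa _ μ := h1.div h2 hD.ne'
  rw [h3.deriv]
  refine div_neg_of_neg_of_pos ?_ (by positivity)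
  have key := kappa_trig_inequality (y := π * μ) (by nlinarith [hμ.1]) (by nlinarith [hμ.2])
  have e1 : 2 * (π * μ) = 2 * π * μ := by ring
  rw [e1] at key
  have e2 : (1 - cos (2 * π * μ)) * (μ - sin (π * μ) / π) =
      ((1 - cos (2 * π * μ)) * (π * μ - sin (π * μ))) / π := by field_simp
  have e3 : (μ - sin (2 * π * μ) / (2 * π)) * (1 - cos (π * μ)) =
      ((π * μ - sin (2 * π * μ) / 2) * (1 - cos (π * μ))) / π := by field_simp
  rw [e2, e3, sub_neg]
  gcongr

theorem kappa_eq {μ : ℝ} : kappa μ =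
    (π * μ - sin (π * μ) * cos (π * μ)) / (π * μ - sin (π * μ)) := by
  have hpi := Real.pi_pos
  rw [kappa, show 2 * π * μ = 2 * (π * μ) by ring, sin_two_mul]
  have e1 : μ - 2 * sin (π * μ) * cos (π * μ) / (2 * π) =
      (π * μ - sin (π * μ) * cos (π * μ)) / π := by field_simp
  have e2 : μ - sin (π * μ) / π = (π * μ - sin (π * μ)) / π := by field_simp
  rw [e1, e2, div_div_div_cancel_right₀ hpi.ne']

/-! ### Location of the critical density -/

theorem sin_cos_near_two_pi_div_three (δ : ℝ) :
    sin (2 * π / 3 + δ) = √3 / 2 * cos δ - 1 / 2 * sin δ ∧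
    cos (2 * π / 3 + δ) = -(1 / 2 * cos δ + √3 / 2 * sin δ) := by
  rw [show 2 * π / 3 + δ = π - (π / 3 - δ) by ring, Real.sin_pi_sub, Real.cos_pi_sub, sin_sub,
    cos_sub, Real.sin_pi_div_three, Real.cos_pi_div_three]
  exact ⟨rfl, rfl⟩

theorem two_lt_kappa_at_lower : 2 < kappa 0.675 := by
  have hpi := Real.pi_lt_d4
  have hpi' := Real.pi_gt_d4
  rw [kappa_eq, show π * 0.675 = 2 * π / 3 + π / 120 by ring]
  obtain ⟨e1, e2⟩ := sin_cos_near_two_pi_div_three (π / 120)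
  have hlt : sin (2 * π / 3 + π / 120) < 2 * π / 3 + π / 120 := Real.sin_lt (by linarith)
  -- With y = πμ, κ(μ) > 2 amounts to y < sin y (2 - cos y). The point y is written as a small
  -- offset from 2π/3, where sine and cosine are explicit.
  rw [lt_div_iff₀ (by linarith)]
  have a1 := Real.one_sub_sq_div_two_le_cos (x := π / 120)
  have a2 := Real.sin_le (x := π / 120) (by linarith)
  have a3 : 0 ≤ sin (π / 120) := sin_nonneg_of_nonneg_of_le_pi (by linarith) (by linarith)
  have a4 : 1.732 ≤ √3 := Real.le_sqrt_of_sq_le (by norm_num)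
  have a5 : 0.9996 ≤ cos (π / 120) := by nlinarith
  have b1 : 0.8525 ≤ sin (2 * π / 3 + π / 120) := by
    have := mul_le_mul a4 a5 (by norm_num) (by linarith)
    rw [e1]; linarith
  have b2 : cos (2 * π / 3 + π / 120) ≤ -0.4998 := by
    have := mul_nonneg (Real.sqrt_nonneg 3) a3
    rw [e2]; linarith
  have b3 : 0.8525 * 2.4998 ≤
      sin (2 * π / 3 + π / 120) * (2 - cos (2 * π / 3 + π / 120)) :=
    mul_le_mul b1 (by linarith) (by norm_num) (by linarith)
  linarith

theorem kappa_at_upper_lt_two : kappa 0.685 < 2 := by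
  have hpi := Real.pi_lt_d4
  have hpi' := Real.pi_gt_d4
  rw [kappa_eq, show π * 0.685 = 2 * π / 3 + 11 * π / 600 by ring]
  obtain ⟨e1, e2⟩ := sin_cos_near_two_pi_div_three (11 * π / 600)
  have hlt : sin (2 * π / 3 + 11 * π / 600) < 2 * π / 3 + 11 * π / 600 :=
    Real.sin_lt (by linarith)
  rw [div_lt_iff₀ (by linarith)]
  have a1 := cos_le_one (11 * π / 600)
  have a2 := Real.sin_le (x := 11 * π / 600) (by linarith)
  have a3 := Real.sin_ge_sub_cube (x := 11 * π / 600) (by linarith)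
  have a4 : √3 ≤ 1.7321 := Real.sqrt_le_iff.2 ⟨by norm_num, by norm_num⟩
  have a5 : 0 ≤ cos (11 * π / 600) := cos_nonneg_of_neg_pi_div_two_le_of_le (by linarith)
    (by linarith)
  have a6 : 0.0575 ≤ sin (11 * π / 600) := by
    have : (11 * π / 600) ^ 3 ≤ 0.0577 ^ 3 :=
      pow_le_pow_left₀ (by linarith) (by linarith) 3
    norm_num at this ⊢
    linarith
  have b1 : sin (2 * π / 3 + 11 * π / 600) ≤ 0.8374 := by
    have := mul_le_mul a4 a1 a5 (by norm_num)
    rw [e1]; linarith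
  have b2 : -0.55 ≤ cos (2 * π / 3 + 11 * π / 600) := by
    have := mul_le_mul a4 (by linarith : sin (11 * π / 600) ≤ 0.0577) (by linarith) (by norm_num)
    rw [e2]; linarith
  have b3 : sin (2 * π / 3 + 11 * π / 600) * (2 - cos (2 * π / 3 + 11 * π / 600)) ≤
      0.8374 * 2.55 :=
    mul_le_mul b1 (by linarith) (by linarith [cos_le_one (2 * π / 3 + 11 * π / 600)])
      (by norm_num)
  linarith

theorem exists_kappa_eq_two : ∃ μ : ℝ, |μ - 0.68| < 0.005 ∧ kappa μ = 2 := by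
  have hc : ContinuousOn kappa (Set.Icc 0.675 0.685) := fun μ hμ =>
    (analyticAt_kappa (by linarith [hμ.1])).continuousAt.continuousWithinAt
  obtain ⟨μ, hμ, he⟩ := intermediate_value_Icc' (by norm_num) hc
    ⟨kappa_at_upper_lt_two.le, two_lt_kappa_at_lower.le⟩
  refine ⟨μ, ?_, he⟩
  have h1 : μ ≠ 0.675 := by
    rintro rfl; linarith [two_lt_kappa_at_lower]
  have h2 : μ ≠ 0.685 := by
    rintro rfl; linarith [kappa_at_upper_lt_two]
  have h3 := lt_of_le_of_ne hμ.1 h1.symm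
  have h4 := lt_of_le_of_ne hμ.2 h2
  rw [abs_lt]
  constructor <;> linarith

/-! ### The limit of the condition number -/

theorem abs_sin_nat_mul_le (j : ℕ) (b : ℝ) : |sin (j * b)| ≤ j * |sin b| := by
  induction j with
  | zero => simp
  | succ j ih =>
    push_cast
    rw [add_mul, one_mul, sin_add]
    refine (abs_add_le _ _).trans ?_
    rw [abs_mul, abs_mul]
    have h1 := mul_le_mul_of_nonneg_left (abs_cos_le_one b) (abs_nonneg (sin (j * b)))
    have h2 := mul_le_mul_of_nonneg_right (abs_cos_le_one (j * b)) (abs_nonneg (sin b))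
    linarith

/-- Mode 2 has the largest limiting eigenvalue. With a = π(1 - μ) ≤ 0.4π the claim becomes 2(-1)^m
sin(ma) ≤ m sin 2a. Even m follow from |sin(jb)| ≤ j|sin b|; odd m are harmless while ma ≤ π, after
which m = 3 is compared directly and m ≥ 5 has m sin 2a ≥ 2. -/
theorem sin_two_mul_div_le {μ : ℝ} (h1 : 0.6 ≤ μ) (h2 : μ ≤ 1) {m : ℕ} (hm : 1 ≤ m) :
    sin (2 * (π * μ)) / 2 ≤ sin (m * (π * μ)) / m := by
  have hpi := Real.pi_pos
  have hm' : (1 : ℝ) ≤ m := by exact_mod_cast hm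
  obtain ⟨a, ha⟩ : ∃ a, a = π * (1 - μ) := ⟨_, rfl⟩
  have ha0 : 0 ≤ a := by rw [ha]; exact mul_nonneg hpi.le (by linarith)
  have ha1 : a ≤ 0.4 * π := by rw [ha]; nlinarith
  have e0 : π * μ = π - a := by rw [ha]; ring
  have e2 : sin (2 * (π * μ)) = - sin (2 * a) := by
    rw [e0, show 2 * (π - a) = 2 * π - 2 * a by ring, Real.sin_two_pi_sub]
  have em : sin (m * (π * μ)) = - ((-1) ^ m * sin (m * a)) := by
    rw [e0, mul_sub, Real.sin_nat_mul_pi_sub]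
  have hs2 : 0 ≤ sin (2 * a) := sin_nonneg_of_nonneg_of_le_pi (by linarith) (by linarith)
  rw [e2, em, div_le_div_iff₀ two_pos (by linarith)]
  suffices (-1) ^ m * sin (m * a) * 2 ≤ m * sin (2 * a) by linarith
  rcases Nat.even_or_odd m with he | ho
  · rw [he.neg_one_pow, one_mul]
    obtain ⟨j, rfl⟩ := he
    have := (le_abs_self _).trans (abs_sin_nat_mul_le j (2 * a))
    rw [abs_of_nonneg hs2, show (j : ℝ) * (2 * a) = ((j + j : ℕ) : ℝ) * a by push_cast; ring] at this
    push_cast at this ⊢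
    linarith
  · rw [ho.neg_one_pow]
    by_cases hma : m * a ≤ π
    · have : 0 ≤ sin (m * a) := sin_nonneg_of_nonneg_of_le_pi (by positivity) hma
      have : 0 ≤ m * sin (2 * a) := by positivity
      linarith
    · push Not at hma
      have hs5 := lt_sin_pi_div_five
      have hlarge : π / 2 ≤ 2 * a → sin (0.2 * π) ≤ sin (2 * a) := by
        intro h
        rw [← Real.sin_pi_sub (2 * a)]
        exact Real.sin_le_sin_of_le_of_le_pi_div_two (by linarith) (by linarith) (by linarith)
      have hm3 : m = 3 ∨ 5 ≤ m := by
        obtain ⟨j, rfl⟩ := ho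
        rcases Nat.eq_zero_or_pos j with rfl | hj
        · push_cast at hma; linarith
        · omega
      rcases hm3 with rfl | h5
      · push_cast at *
        have b1 := hlarge (by linarith)
        have b2 : sin (3 * a) = - sin (3 * a - π) := by rw [Real.sin_sub_pi, neg_neg]
        have b3 : sin (3 * a - π) ≤ sin (0.2 * π) :=
          Real.sin_le_sin_of_le_of_le_pi_div_two (by linarith) (by linarith) (by linarith)
        rw [b2]; linarith
      · have h5' : (5 : ℝ) ≤ m := by exact_mod_cast h5
        have b1 : 2 ≤ m * sin (2 * a) := by
          rcases le_or_gt (2 * a) (π / 2) with h | h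
          · have c1 := Real.mul_le_sin (by linarith : 0 ≤ 2 * a) h
            have c2 : (m : ℝ) * (2 / π * (2 * a)) = 4 * (m * a) / π := by ring
            have c3 : 4 ≤ 4 * (m * a) / π := by rw [le_div_iff₀ hpi]; linarith
            have c4 := mul_le_mul_of_nonneg_left c1 (by linarith : (0 : ℝ) ≤ m)
            linarith
          · have := hlarge h.le
            nlinarith
        have := neg_one_le_sin (m * a)
        linarith

theorem tendsto_mul_sin_div (c : ℝ) (hc : c ≠ 0) :
    Tendsto (fun n : ℕ => (n : ℝ) * sin (c * (1 / n))) atTop (𝓝 c) := by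
  have h1 : Tendsto (fun n : ℕ => c * (1 / (n : ℝ))) atTop (𝓝 0) := by
    simpa using (tendsto_one_div_atTop_nhds_zero_nat (𝕜 := ℝ)).const_mul c
  have h2 : Tendsto (fun n : ℕ => c * Real.sinc (c * (1 / n))) atTop (𝓝 (c * Real.sinc 0)) :=
    ((Real.continuous_sinc.tendsto 0).comp h1).const_mul c
  rw [Real.sinc_zero, mul_one] at h2
  refine h2.congr' ?_
  filter_upwards [eventually_gt_atTop 0] with n hn
  have hn' : (0 : ℝ) < n := by exact_mod_cast hn
  rw [Real.sinc_of_ne_zero (by positivity)]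
  field_simp

theorem HasDensity.tendsto_ratio {n k : ℕ → ℕ} {μ : ℝ} (h : HasDensity n k μ) :
    Tendsto (fun j => (2 * (k j : ℝ) + 1) / n j) atTop (𝓝 μ) := by
  obtain ⟨-, hn, -, hd⟩ := h
  have h1 : Tendsto (fun j => 1 / (n j : ℝ)) atTop (𝓝 0) :=
    (tendsto_one_div_atTop_nhds_zero_nat (𝕜 := ℝ)).comp hn
  simpa [add_div] using hd.add h1

theorem HasDensity.le_one {n k : ℕ → ℕ} {μ : ℝ} (h : HasDensity n k μ) : μ ≤ 1 := by
  refine le_of_tendsto h.tendsto_ratio (Eventually.of_forall fun j => ?_)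
  have := (h.1 j).2
  have h1 : (2 * (k j : ℝ) + 1) ≤ n j := by exact_mod_cast this
  exact div_le_one_of_le₀ h1 (by positivity)

theorem HasDensity.tendsto_lam {n k : ℕ → ℕ} {μ : ℝ} (h : HasDensity n k μ) (hμ : 0 < μ) {m : ℕ}
    (hm : 1 ≤ m) : Tendsto (fun j => lam (n j) (k j) m / (2 * k j + 1)) atTop
      (𝓝 (1 - sin (m * (π * μ)) / (m * (π * μ)))) := by
  have hr := h.tendsto_ratio
  have hm' : (0 : ℝ) < m := by exact_mod_cast hm
  have h1 : Tendsto (fun j => sin (m * (π * ((2 * (k j : ℝ) + 1) / n j)))) atTop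
      (𝓝 (sin (m * (π * μ)))) :=
    (Real.continuous_sin.tendsto _).comp ((hr.const_mul π).const_mul (m : ℝ))
  have h2 := (tendsto_mul_sin_div (m * π) (by positivity)).comp h.2.1
  have h3 := hr.mul h2
  have h4 := (tendsto_const_nhds (x := (1 : ℝ))).sub (h1.div h3 (by positivity))
  rw [show μ * (m * π) = m * (π * μ) by ring] at h4
  refine h4.congr' ?_
  filter_upwards [h.2.1.eventually (eventually_gt_atTop m)] with j hj
  have hn0 : (0 : ℝ) < n j := by exact_mod_cast (by omega : 0 < n j)
  have hs := sin_natCast_mul_angle_pos hm hj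
  rw [lam_eq _ hm hj]
  simp only [Function.comp_apply, Pi.div_apply]
  have e1 : (m : ℝ) * (π * ((2 * (k j : ℝ) + 1) / n j)) = (2 * k j + 1) * (m * (π / n j)) := by
    ring
  have e2 : (m : ℝ) * π * (1 / n j) = m * (π / n j) := by ring
  have e3 : (2 * (k j : ℝ) + 1) / n j * (n j * sin (m * (π / n j))) =
      (2 * k j + 1) * sin (m * (π / n j)) := by
    rw [← mul_assoc, div_mul_cancel₀ _ hn0.ne']
  have hq : (0 : ℝ) < 2 * k j + 1 := by positivity
  rw [e1, e2, e3, sub_div, div_self hq.ne', div_div, mul_comm (sin (m * (π / n j)))]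

theorem exists_lam_eq_eig_top {n k : ℕ} (h : Admissible n k) :
    ∃ m, 1 ≤ m ∧ 2 * m ≤ n ∧ eig (lap_isHermitian n k) n = lam n k m := by
  obtain ⟨m, hm1, hm2, he⟩ := (eig_top_eq h).1
  by_cases hc : 2 * m ≤ n
  · exact ⟨m, hm1, hc, he⟩
  · refine ⟨n - m, by omega, by omega, ?_⟩
    rw [he, Nat.cast_sub hm2.le, lam_reflect k (by omega)]

theorem HasDensity.tendsto_eig_top {n k : ℕ → ℕ} {μ : ℝ} (h : HasDensity n k μ) (hμ : 0.6 ≤ μ) :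
    Tendsto (fun j => eig (lap_isHermitian (n j) (k j)) (n j) / (2 * k j + 1)) atTop
      (𝓝 (1 - sin (2 * (π * μ)) / (2 * (π * μ)))) := by
  have hpi := Real.pi_pos
  have hμ1 := h.le_one
  have hμ0 : 0 < μ := by linarith
  have h2 := h.tendsto_lam hμ0 (m := 2) (by norm_num)
  push_cast at h2
  have hℓ : ∀ m : ℕ, 1 ≤ m → 1 - sin (m * (π * μ)) / (m * (π * μ)) ≤
      1 - sin (2 * (π * μ)) / (2 * (π * μ)) := by
    intro m hm
    have hm' : (0 : ℝ) < m := by exact_mod_cast hm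
    rw [sub_le_sub_iff_left, ← div_div (sin (2 * (π * μ))), ← div_div (sin (m * (π * μ)))]
    exact div_le_div_of_nonneg_right (sin_two_mul_div_le hμ hμ1 hm) (by positivity)
  have hℓ1 : 1 ≤ 1 - sin (2 * (π * μ)) / (2 * (π * μ)) := by
    have : sin (2 * (π * μ)) ≤ 0 := by
      rw [← Real.sin_sub_two_pi]
      refine sin_nonpos_of_nonpos_of_neg_pi_le ?_ ?_ <;> nlinarith
    have : sin (2 * (π * μ)) / (2 * (π * μ)) ≤ 0 :=
      div_nonpos_of_nonpos_of_nonneg this (by positivity)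
    linarith
  set ℓ := 1 - sin (2 * (π * μ)) / (2 * (π * μ)) with hℓdef
  refine tendsto_order.2 ⟨fun b hb => ?_, fun b hb => ?_⟩
  · filter_upwards [(tendsto_order.1 h2).1 b hb] with j hj
    refine hj.trans_le ?_
    have := (eig_top_eq (h.1 j)).2 2
    push_cast at this
    gcongr
  -- The maximizing mode may vary with j, so pointwise limits are not enough. Modes up to M are
  -- finitely many; beyond M the quotient is at most n/(2(M+1)) < q/(M+1) < q(b - ℓ), using q > n/2,
  -- and ℓ ≥ 1 absorbs the main term.
  · obtain ⟨M, hM⟩ := exists_nat_one_div_lt (sub_pos.2 hb)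
    have hfin : ∀ᶠ j in atTop, ∀ m ∈ Finset.Icc 1 M, lam (n j) (k j) m / (2 * k j + 1) < b := by
      rw [Filter.eventually_all_finset]
      intro m hm
      rw [Finset.mem_Icc] at hm
      exact (tendsto_order.1 (h.tendsto_lam hμ0 hm.1)).2 b ((hℓ m hm.1).trans_lt hb)
    have hhalf : ∀ᶠ j in atTop, 1 / 2 < (2 * (k j : ℝ) + 1) / n j :=
      (tendsto_order.1 h.tendsto_ratio).1 _ (by linarith)
    filter_upwards [hfin, hhalf] with j hj hj2
    obtain ⟨m, hm1, hm2, he⟩ := exists_lam_eq_eig_top (h.1 j)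
    rw [he]
    by_cases hmM : m ≤ M
    · exact hj m (Finset.mem_Icc.2 ⟨hm1, hmM⟩)
    · have hn0 : 0 < n j := by omega
      have hn' : (0 : ℝ) < n j := by exact_mod_cast hn0
      have hq : (0 : ℝ) < 2 * k j + 1 := by positivity
      rw [lt_div_iff₀ hn'] at hj2
      have hsin : 2 * ((M : ℝ) + 1) / n j ≤ sin (((M + 1 : ℕ) : ℝ) * (π / n j)) := by
        have hle := natCast_mul_angle_le (m := M + 1) hn0 (1 / 2) (by
          have : (2 : ℝ) * ((M + 1 : ℕ) : ℝ) ≤ n j := by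
            exact_mod_cast (by omega : 2 * (M + 1) ≤ n j)
          linarith)
        have := Real.mul_le_sin (x := ((M + 1 : ℕ) : ℝ) * (π / n j)) (by positivity)
          (by linarith)
        refine le_trans (le_of_eq ?_) this
        push_cast
        field_simp
      have habs := neg_le_of_abs_le (abs_sin_div_sin_le (n := n j) (m := m) (a := M + 1) (by omega)
        (by omega) hm2 ((2 * k j + 1) * (m * (π / n j))))
      have hM0 : (0 : ℝ) < M + 1 := by positivity
      have hinv : 1 / sin (((M + 1 : ℕ) : ℝ) * (π / n j)) ≤ n j / (2 * ((M : ℝ) + 1)) := by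
        have := one_div_le_one_div_of_le (by positivity) hsin
        rwa [one_div_div] at this
      rw [lam_eq _ hm1 (by omega), div_lt_iff₀ hq]
      have hfin2 : (n j : ℝ) / (2 * ((M : ℝ) + 1)) < (2 * k j + 1) * (1 / (M + 1)) := by
        rw [mul_one_div, div_lt_div_iff₀ (by positivity) hM0]
        nlinarith
      have : (2 * (k j : ℝ) + 1) * (1 / (M + 1)) < (2 * k j + 1) * (b - ℓ) := by gcongr
      have : (2 * (k j : ℝ) + 1) * 1 ≤ (2 * k j + 1) * ℓ := by gcongr
      linarith

theorem HasDensity.tendsto_condNumber {n k : ℕ → ℕ} {μ : ℝ} (h : HasDensity n k μ)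
    (hμ : 0.6 ≤ μ) : Tendsto (fun j => condNumber (n j) (k j)) atTop (𝓝 (kappa μ)) := by
  have hpi := Real.pi_pos
  have hμ0 : 0 < μ := by linarith
  have h1 := h.tendsto_lam hμ0 (m := 1) le_rfl
  simp only [Nat.cast_one, one_mul] at h1
  have h2 := h.tendsto_eig_top hμ
  have e1 : 1 - sin (π * μ) / (π * μ) = (μ - sin (π * μ) / π) / μ := by field_simp
  have e2 : 1 - sin (2 * (π * μ)) / (2 * (π * μ)) = (μ - sin (2 * π * μ) / (2 * π)) / μ := by
    rw [← mul_assoc]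
    field_simp
  have hD := kappa_denominator_pos hμ0
  have h3 := h2.div h1 (by rw [e1]; positivity)
  rw [e1, e2, div_div_div_cancel_right₀ hμ0.ne'] at h3
  refine h3.congr fun j => ?_
  have hq : (2 * (k j : ℝ) + 1) ≠ 0 := by positivity
  rw [Pi.div_apply, div_div_div_cancel_right₀ hq, condNumber, eig_two_eq (h.1 j)]

/-! ### Stability of the twisted state and the condition number -/

theorem weig_one_one (n k : ℕ) : weig n k 1 1 = lam n k 2 / 2 - lam n k 1 := by
  rw [weig_one, sub_self, lam_zero, add_zero, one_add_one_eq_two]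

/-- For 2 ≤ m ≤ n-2 both λ(m ± 1) are at least λ(1), and one of them strictly exceeds it because its
index lies in [2, n-2]. The modes 1 and n-1 are the critical pair. -/
theorem weig_one_pos {n k : ℕ} (h : Admissible n k) (hgap : 2 * k + 3 ≤ n)
    (h2 : 2 * lam n k 1 < lam n k 2) {m : ℕ} (hm : 1 ≤ m) (hmn : m < n) : 0 < weig n k 1 m := by
  have hk := h.1
  have hn0 : n ≠ 0 := by omega
  rcases (show m = 1 ∨ m + 1 = n ∨ (2 ≤ m ∧ m + 2 ≤ n) by omega) with rfl | he | ⟨h3, h4⟩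
  · rw [Nat.cast_one, weig_one_one]; linarith
  · have e : (m : ℝ) = n - 1 := by
      have : (m : ℝ) + 1 = n := by exact_mod_cast he
      linarith
    rw [weig_one, e, show (n : ℝ) - 1 + 1 = n - 0 by ring, show (n : ℝ) - 1 - 1 = n - 2 by ring,
      lam_reflect k hn0, lam_reflect k hn0, lam_zero]
    linarith
  · have e1 : (m : ℝ) + 1 = ((m + 1 : ℕ) : ℝ) := by push_cast; ring
    have e2 : (m : ℝ) - 1 = ((m - 1 : ℕ) : ℝ) := by
      rw [Nat.cast_sub (by omega)]; simp
    rw [weig_one, e1, e2]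
    have a1 := lam_one_le h (m := m + 1) (by omega) (by omega)
    have a2 := lam_one_le h (m := m - 1) (by omega) (by omega)
    by_cases hc : m + 3 ≤ n
    · have := lam_one_lt h hgap (m := m + 1) (by omega) (by omega)
      linarith
    · have := lam_one_lt h hgap (m := m - 1) (by omega) (by omega)
      linarith

theorem isStableEquilibrium_twisted {n k : ℕ} (hn : 40 ≤ n) (h : Admissible n k)
    (hd : (2 * k + 1 : ℝ) ≤ 0.7 * n) (h2 : 2 * lam n k 1 < lam n k 2) {K : ℝ} (hK : 0 < K) :
    IsStableEquilibrium K (adj n k) (twisted n) := by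
  have hgap : 2 * k + 3 ≤ n := by
    have hn' : (40 : ℝ) ≤ n := by exact_mod_cast hn
    have : ((2 * k + 3 : ℕ) : ℝ) ≤ n := by push_cast; linarith
    exact_mod_cast this
  exact isStableEquilibrium_of_weig_pos h (fun m => weig_one_pos h hgap h2) hK

theorem condNumber_eq {n k : ℕ} (h : Admissible n k) :
    condNumber n k = eig (lap_isHermitian n k) n / lam n k 1 := by
  rw [condNumber, eig_two_eq h]

theorem lam_one_pos {n k : ℕ} (h : Admissible n k) : 0 < lam n k 1 := by
  have := lam_pos h (m := 1) le_rfl (by have := h.1; have := h.2; omega)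
  rwa [Nat.cast_one] at this

theorem isStableEquilibrium_of_two_lt_condNumber {n k : ℕ} (hn : 40 ≤ n) (h : Admissible n k)
    (hc : 2 < condNumber n k) {K : ℝ} (hK : 0 < K) :
    IsStableEquilibrium K (adj n k) (twisted n) := by
  rw [condNumber_eq h, lt_div_iff₀ (lam_one_pos h)] at hc
  obtain ⟨m, hm1, hm2, he⟩ := (eig_top_eq h).1
  rw [he] at hc
  rcases le_or_gt (2 * k + 1 : ℝ) (0.6 * n) with h6 | h6
  · exact isStableEquilibrium_twisted hn h (h6.trans (by gcongr; norm_num))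
      (two_mul_lam_one_lt_of_le h h6) hK
  · rcases le_or_gt (2 * k + 1 : ℝ) (0.7 * n) with h7 | h7
    · exact isStableEquilibrium_twisted hn h h7
        (hc.trans_le (lam_le_lam_two (by omega) h6.le h7 hm1 hm2)) hK
    · exact absurd (lam_le_two_mul_lam_one hn h h7.le hm1 hm2) (not_le.2 hc)

/-- λ(2) is at most the top eigenvalue, so w(1) < 0; no knowledge of the maximizing mode is needed.
-/
theorem not_isStableEquilibrium_of_condNumber_lt_two {n k : ℕ} (h : Admissible n k)
    (hc : condNumber n k < 2) {K : ℝ} (hK : 0 < K) :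
    ¬ IsStableEquilibrium K (adj n k) (twisted n) := by
  rw [condNumber_eq h, div_lt_iff₀ (lam_one_pos h)] at hc
  have h2 := (eig_top_eq h).2 2
  push_cast at h2
  exact not_isStableEquilibrium_of_weig_neg h (by rw [weig_one_one]; linarith) hK

theorem not_isSynchronized_twisted {n : ℕ} (hn : 2 ≤ n) : ¬ IsSynchronized (twisted n) := by
  intro h
  have h1 := h ⟨1, by omega⟩ ⟨0, by omega⟩
  have hn' : (2 : ℝ) ≤ n := by exact_mod_cast hn
  rw [Real.Angle.angle_eq_iff_two_pi_dvd_sub] at h1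
  obtain ⟨a, ha⟩ := h1
  simp only [twisted, Nat.cast_one, Nat.cast_zero, mul_zero, zero_div, sub_zero, mul_one] at ha
  have hpi := Real.pi_pos
  have h2 : (a : ℝ) * n = 1 := by
    field_simp at ha
    linarith
  have h3 : a * (n : ℤ) = 1 := by exact_mod_cast h2
  have h4 := Int.eq_one_or_neg_one_of_mul_eq_one' h3
  omega

theorem isCriticalDensity_of_kappa_eq_two {μc : ℝ} (hμc : |μc - 0.68| < 0.005)
    (hκ : kappa μc = 2) {K : ℝ} (hK : 0 < K) : IsCriticalDensity K μc := by
  rw [abs_lt] at hμc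
  have hmem : μc ∈ Set.Icc (0.6 : ℝ) 1 := ⟨by linarith, by linarith⟩
  intro n k μ hd
  have hμ1 := hd.le_one
  refine ⟨fun hlt => ?_, fun hlt => ?_⟩
  · have hlarge := hd.2.1.eventually (eventually_ge_atTop 40)
    -- The limit κ(μ) is available only from 0.6 on; lower densities are stable by the direct
    -- comparison of λ(2) with 2λ(1).
    rcases lt_or_ge μ 0.6 with h6 | h6
    · filter_upwards [hlarge, (tendsto_order.1 hd.tendsto_ratio).2 _ h6] with j hj hr
      have hn' : (0 : ℝ) < n j := by exact_mod_cast (by omega : 0 < n j)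
      rw [div_lt_iff₀ hn'] at hr
      exact isStableEquilibrium_twisted hj (hd.1 j) (hr.le.trans (by gcongr; norm_num))
        (two_mul_lam_one_lt_of_le (hd.1 j) hr.le) hK
    · have hκμ := strictAntiOn_kappa ⟨h6, hμ1⟩ hmem hlt
      rw [hκ] at hκμ
      filter_upwards [hlarge, (tendsto_order.1 (hd.tendsto_condNumber h6)).1 _ hκμ] with j hj hc
      exact isStableEquilibrium_of_two_lt_condNumber hj (hd.1 j) hc hK
  · have h6 : 0.6 ≤ μ := by linarith
    have hκμ := strictAntiOn_kappa hmem ⟨h6, hμ1⟩ hlt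
    rw [hκ] at hκμ
    filter_upwards [(tendsto_order.1 (hd.tendsto_condNumber h6)).2 _ hκμ] with j hc
    exact not_isStableEquilibrium_of_condNumber_lt_two (hd.1 j) hc hK

/-! ### Graphs with condition number just above 2 -/

theorem exists_hasDensity {μ : ℝ} (h1 : 0.6 ≤ μ) (h2 : μ ≤ 0.7) : ∃ n k, HasDensity n k μ := by
  have hx : Tendsto (fun j : ℕ => ((j + 10 : ℕ) : ℝ)) atTop atTop :=
    tendsto_natCast_atTop_atTop.comp (tendsto_add_atTop_nat 10)
  -- Starting at n = 10 makes every term admissible: μn/2 ≥ 3 and (1 - μ)n ≥ 3.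
  refine ⟨fun j => j + 10, fun j => ⌊μ / 2 * ((j + 10 : ℕ) : ℝ)⌋₊, fun j => ⟨?_, ?_⟩,
    tendsto_add_atTop_nat 10, ?_, ?_⟩
  · rw [Nat.one_le_floor_iff]
    push_cast
    nlinarith [(Nat.cast_nonneg j : (0 : ℝ) ≤ j)]
  · have hfl := Nat.floor_le (a := μ / 2 * ((j + 10 : ℕ) : ℝ)) (by positivity)
    have : (((2 * ⌊μ / 2 * ((j + 10 : ℕ) : ℝ)⌋₊ + 1 : ℕ)) : ℝ) ≤ ((j + 10 : ℕ) : ℝ) := by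
      push_cast at hfl ⊢
      nlinarith [(Nat.cast_nonneg j : (0 : ℝ) ≤ j)]
    exact_mod_cast this
  · exact tendsto_nat_floor_atTop.comp (hx.const_mul_atTop (by linarith))
  · have := ((tendsto_nat_floor_mul_div_atTop (R := ℝ) (a := μ / 2) (by linarith)).comp
      hx).const_mul 2
    rw [mul_div_cancel₀ _ (two_ne_zero' ℝ)] at this
    refine this.congr fun j => ?_
    simp only [Function.comp_apply, mul_div_assoc]

/-- A density slightly below the critical one has κ strictly between 2 and 2 + ε, and large graphs
of that density inherit both strict bounds. -/
theorem exists_condNumber_le {ε : ℝ} (hε : 0 < ε) : ∃ n k : ℕ, 40 ≤ n ∧ Admissible n k ∧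
    condNumber n k ≤ 2 + ε ∧ 2 < condNumber n k := by
  obtain ⟨μc, hμc, hκ⟩ := exists_kappa_eq_two
  rw [abs_lt] at hμc
  have hcont : Tendsto kappa (𝓝[<] μc) (𝓝 2) := by
    have := (analyticAt_kappa (μ := μc) (by linarith)).continuousAt.tendsto
    rw [hκ] at this
    exact this.mono_left nhdsWithin_le_nhds
  have h6 : ∀ᶠ μ in 𝓝[<] μc, (0.6 : ℝ) < μ :=
    mem_nhdsWithin_of_mem_nhds (Ioi_mem_nhds (by linarith))
  obtain ⟨μ, hμκ, hμ6, hμlt⟩ := (((tendsto_order.1 hcont).2 (2 + ε) (by linarith)).and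
    (h6.and self_mem_nhdsWithin)).exists
  have hgt := strictAntiOn_kappa ⟨hμ6.le, by linarith⟩ ⟨by linarith, by linarith⟩ hμlt
  rw [hκ] at hgt
  obtain ⟨n, k, hd⟩ := exists_hasDensity hμ6.le (by linarith : μ ≤ 0.7)
  have hlim := tendsto_order.1 (hd.tendsto_condNumber hμ6.le)
  obtain ⟨j, hj1, hj2, hj3⟩ := ((hlim.1 _ hgt).and ((hlim.2 _ hμκ).and
    (hd.2.1.eventually (eventually_ge_atTop 40)))).exists
  exact ⟨n j, k j, hj3, hd.1 j, hj2.le, hj1⟩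

end Kuramoto

/-! ### The main theorem -/

theorem theorem3p5 :
    -- for large `n`, a condition number `> 2` makes the twisted state a spurious stable equilibrium
    (∃ N : ℕ, ∀ n k : ℕ, N ≤ n → Kuramoto.Admissible n k → 2 < Kuramoto.condNumber n k →
      ¬ Kuramoto.IsSynchronized (Kuramoto.twisted n) ∧
      ∀ K : ℝ, 0 < K →
        Kuramoto.IsStableEquilibrium K (Kuramoto.adj n k) (Kuramoto.twisted n)) ∧
    -- the limit of the condition number at density `μ ≥ 0.6`
    ((∀ (n k : ℕ → ℕ) (μ : ℝ), Kuramoto.HasDensity n k μ → 0.6 ≤ μ →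
        Filter.Tendsto (fun j => Kuramoto.condNumber (n j) (k j)) Filter.atTop
          (nhds (Kuramoto.kappa μ))) ∧
      AnalyticOnNhd ℝ Kuramoto.kappa (Set.Icc 0.6 1) ∧
      StrictAntiOn Kuramoto.kappa (Set.Icc 0.6 1) ∧
      ∃ μc : ℝ, |μc - 0.68| < 0.005 ∧
        (∀ K : ℝ, 0 < K → Kuramoto.IsCriticalDensity K μc) ∧
        Kuramoto.kappa μc = 2) ∧
    -- condition numbers arbitrarily close to `2` do not exclude spurious stable equilibria
    (∀ ε : ℝ, 0 < ε → ∃ n k : ℕ, Kuramoto.Admissible n k ∧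
      Kuramoto.condNumber n k ≤ 2 + ε ∧
      ¬ Kuramoto.IsSynchronized (Kuramoto.twisted n) ∧
      ∀ K : ℝ, 0 < K →
        Kuramoto.IsStableEquilibrium K (Kuramoto.adj n k) (Kuramoto.twisted n)) := by
  refine ⟨⟨40, fun n k hn h hc => ⟨Kuramoto.not_isSynchronized_twisted (by omega), fun K hK =>
    Kuramoto.isStableEquilibrium_of_two_lt_condNumber hn h hc hK⟩⟩,
    ⟨fun n k μ hd hμ => hd.tendsto_condNumber hμ,
      fun μ hμ => Kuramoto.analyticAt_kappa (by linarith [hμ.1]),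
      Kuramoto.strictAntiOn_kappa, ?_⟩, fun ε hε => ?_⟩
  · obtain ⟨μc, hμc, hκ⟩ := Kuramoto.exists_kappa_eq_two
    exact ⟨μc, hμc, fun K hK => Kuramoto.isCriticalDensity_of_kappa_eq_two hμc hκ hK, hκ⟩
  · obtain ⟨n, k, hn, h, hle, hgt⟩ := Kuramoto.exists_condNumber_le hε
    exact ⟨n, k, h, hle, Kuramoto.not_isSynchronized_twisted (by omega), fun K hK =>
      Kuramoto.isStableEquilibrium_of_two_lt_condNumber hn h hgt hK⟩
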